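/- Setting. Let $(S,\Sigma)$ be a measurable space and $X$ a convex subset of a real vector space. An act is a $\Sigma$-measurable finitely valued function $f:S\to X$; $\mathcal F$ is the set of acts, mixtures of acts are statewise, and $x\in X$ is identified with the constant act. Let $\Delta$ be the set of finitely additive probabilities on $\Sigma$ with the weak* topology (setwise convergence on $\Sigma$), $\Delta^\sigma\subseteq\Delta$ the set of countably additive ones, and let $Q\subseteq\Delta^\sigma$ be non-empty, compact and convex. Let $\succsim^*$ and $\succsim$ be binary relations on $\mathcal F$, with asymmetric parts $\succ^*,\succ$ and symmetric parts $\sim^*,\sim$. A relation on $\mathcal F$ is a *preference* if it is reflexive and transitive; monotone (if $f(s)\succsim g(s)$ for all $s\in S$, then $f\succsim g$); continuous (for all $f,g,h\in\mathcal F$ the sets $\{\alpha\in[0,1]:\alpha f+(1-\alpha)g\succsim h\}$ and $\{\alpha\in[0,1]:h\succsim\alpha f+(1-\alpha)g\}$ are closed); and non-trivial ($f\succ g$ for some $f,g$). It is *unbounded* if for all $x,y\in X$ with $x\succ y$ there are $z,z'\in X$ with $\frac12z+\frac12y\succsim x$ and $y\succsim\frac12x+\frac12z'$. It satisfies *independence*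 if for all $f,g,h\in\mathcal F$ and $\alpha\in(0,1)$: $f\succsim g\iff\alpha f+(1-\alpha)h\succsim\alpha g+(1-\alpha)h$. A preference $\succsim$ is *rational* if it is complete and, for $x,y,z\in X$ and $\alpha\in(0,1)$, $x\sim y$ implies $\alpha x+(1-\alpha)z\sim\alpha y+(1-\alpha)z$. A preference $\succsim^*$ is a *dominance relation* if it is complete on $X$; is complete on $\mathcal F$ when $Q$ is a singleton; satisfies, for $f,g\in\mathcal F$, $x,y\in X$, $\alpha\in(0,1)$, that $\alpha f+(1-\alpha)x\succsim^*\alpha g+(1-\alpha)x$ implies $\alpha f+(1-\alpha)y\succsim^*\alpha g+(1-\alpha)y$; and satisfies, for $f,g,h\in\mathcal F$, $\alpha\in(0,1)$, that $f\succsim^*h$ and $g\succsim^*h$ imply $\alpha f+(1-\alpha)g\succsim^*h$. *Consistency*: $f\succsim^*g$ implies $f\succsim g$. *Caution*: for $x\in X$ and $f\in\mathcal F$, $f\not\succsim^*x$ implies $x\succsim f$. *Objective $Q$-coherence* (of $\succsim^*$): if $q(f=g)=1$ for all $q\in Q$, then $f\sim^*g$. *Subjective $Q$-coherence* (of $\succsim$):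 for every $p\in\Delta$, one has $p\in\overline{\mathrm{co}}\,Q$ if and only if, for all $f\in\mathcal F$, $x\in X$ and all $x_f^p\in X$ with $u(x_f^p)=\int u(f)\,dp$ (where $u$ is an affine function representing $\succsim$ on $X$), $x\succ^*x_f^p$ implies $x\succ f$. A *variational statistical distance* for $Q$ is a function $c:\Delta\times Q\to[0,\infty]$ such that each $c(\cdot,q)$ has infimum $0$ and is lower semicontinuous and convex; $c(p,q)=0\iff p=q$; and $c_Q(p)=\min_{q\in Q}c(p,q)$ is well defined for all $p\in\Delta$ (the minimum is attained), has infimum $0$, and is lower semicontinuous and convex in $p$. **Proposition.** The following are equivalent. (i) $\succsim^*$ is an unbounded dominance relation that satisfies independence, $\succsim$ is a rational preference, $\succsim^*$ is objectively $Q$-coherent, $\succsim$ is subjectively $Q$-coherent, and consistency and caution hold. (ii) There exist an affine function $u$ from $X$ onto $\mathbb R$ and a variational statistical distance $c$ for $Q$ such that, for all $(p,q)\in\Delta\times Q$, $c(p,q)=\delta_{\{q\}}(p)$ (that is, $0$ if $p=q$ and $+\infty$ otherwise), and such that, for all $f,g\in\mathcal F$ (all minima being attained), $$f\succsim^*g\iff\min_{p\in\Delta}\Big\{\int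 u(f)\,dp+c(p,q)\Big\}\ge\min_{p\in\Delta}\Big\{\int u(g)\,dp+c(p,q)\Big\}\quad\forall q\in Q,$$ $$f\succsim g\iff\min_{p\in\Delta}\Big\{\int u(f)\,dp+\min_{q\in Q}c(p,q)\Big\}\ge\min_{p\in\Delta}\Big\{\int u(g)\,dp+\min_{q\in Q}c(p,q)\Big\};$$ that is, moreover, for all $f,g\in\mathcal F$, $$f\succsim^*g\iff\int u(f)\,dq\ge\int u(g)\,dq\quad\forall q\in Q,\qquad f\succsim g\iff\min_{q\in Q}\int u(f)\,dq\ge\min_{q\in Q}\int u(g)\,dq.$$ -/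

import Mathlib

open MeasureTheory
open scoped ENNReal

namespace TwoPref

/-! ### Finitely additive probabilities -/

/-- The events, i.e. the members of the σ-algebra `Σ` of `S`. -/
abbrev Event (S : Type*) [MeasurableSpace S] := {A : Set S // MeasurableSet A}

/-- `Δ`: the finitely additive probabilities on `(S, Σ)`, as functions on `Σ`.
The topology inherited from the product `Event S → ℝ` is that of setwise convergence.  Since
`B₀(Σ)` is the span of the indicators of events, this is the weak* topology `σ(ba(Σ), B₀(Σ))`. -/
def Delta (S : Type*) [MeasurableSpace S] : Set (Event S → ℝ) :=
  {p | (∀ A, 0 ≤ p A) ∧ p ⟨Set.univ, MeasurableSet.univ⟩ = 1 ∧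
    ∀ A B : Event S, Disjoint A.1 B.1 → p ⟨A.1 ∪ B.1, A.2.union B.2⟩ = p A + p B}

/-- `Δ^σ`: the countably additive probabilities on `(S, Σ)`. -/
def DeltaSigma (S : Type*) [MeasurableSpace S] : Set (Event S → ℝ) :=
  {p | p ∈ Delta S ∧ ∀ A : ℕ → Event S, Pairwise (fun i j => Disjoint (A i).1 (A j).1) →
    HasSum (fun n => p (A n)) (p ⟨⋃ n, (A n).1, MeasurableSet.iUnion fun n => (A n).2⟩)}

theorem convex_Delta (S : Type*) [MeasurableSpace S] : Convex ℝ (Delta S) := by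
  rintro p ⟨hp0, hp1, hpa⟩ q ⟨hq0, hq1, hqa⟩ a b ha hb hab
  refine ⟨fun A => ?_, ?_, fun A B hAB => ?_⟩
  · simp only [Pi.add_apply, Pi.smul_apply, smul_eq_mul]
    exact add_nonneg (mul_nonneg ha (hp0 A)) (mul_nonneg hb (hq0 A))
  · simp only [Pi.add_apply, Pi.smul_apply, smul_eq_mul, hp1, hq1]
    linarith
  · simp only [Pi.add_apply, Pi.smul_apply, smul_eq_mul, hpa A B hAB, hqa A B hAB]
    ring

/-- The integral `∫ φ dp` of a simple measurable function. -/
noncomputable def integ {S : Type*} [MeasurableSpace S] (p : Event S → ℝ) (φ : SimpleFunc S ℝ) : ℝ :=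
  ∑ r ∈ φ.range, r * p ⟨φ ⁻¹' {r}, φ.measurableSet_fiber r⟩

/-! ### Mixtures and affine functions on a convex set -/

/-- The mixture `α x + (1 - α) y` of two points of a convex set. -/
def mix {E : Type*} [AddCommGroup E] [Module ℝ E] {X : Set E} (hX : Convex ℝ X)
    (α : unitInterval) (x y : X) : X :=
  ⟨(α : ℝ) • (x : E) + (1 - (α : ℝ)) • (y : E),
    hX x.2 y.2 α.2.1 (sub_nonneg.2 α.2.2) (by ring)⟩

/-- The weight `1 / 2`. -/
noncomputable def half : unitInterval := ⟨1 / 2, by norm_num, by norm_num⟩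

/-- `u : X → ℝ` is affine. -/
def IsAffineFn {E : Type*} [AddCommGroup E] [Module ℝ E] {X : Set E} (hX : Convex ℝ X)
    (u : X → ℝ) : Prop :=
  ∀ (α : unitInterval) (x y : X), u (mix hX α x y) = (α : ℝ) * u x + (1 - (α : ℝ)) * u y

/-! ### Statistical distances -/

/-- Grounded: the infimum of the values is `0`. -/
def IsGrounded {ι : Type*} (h : ι → ℝ≥0∞) : Prop := ⨅ i, h i = 0

/-- Convexity of a `[0, ∞]`-valued function on `Δ`, with the convention `0 * ∞ = 0`. -/
def IsConvexFn {S : Type*} [MeasurableSpace S] (h : Delta S → ℝ≥0∞) : Prop :=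
  ∀ (α : unitInterval) (p q : Delta S),
    h (mix (convex_Delta S) α p q)
      ≤ ENNReal.ofReal (α : ℝ) * h p + ENNReal.ofReal (1 - (α : ℝ)) * h q

open Classical in
/-- The convex-analysis indicator function `δ_C`. -/
noncomputable def indicatorFn {S : Type*} [MeasurableSpace S] (C : Set (Event S → ℝ))
    (p : Delta S) : ℝ≥0∞ :=
  if (p : Event S → ℝ) ∈ C then 0 else ⊤

/-- A statistical distance `c : Δ × Q → [0, ∞]` for `Q`. -/
structure IsStatDistance {S : Type*} [MeasurableSpace S] (Q : Set (Event S → ℝ))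
    (c : Delta S → Q → ℝ≥0∞) : Prop where
  grounded : ∀ q : Q, IsGrounded fun p => c p q
  lsc : ∀ q : Q, LowerSemicontinuous fun p => c p q
  convex : ∀ q : Q, IsConvexFn fun p => c p q
  eq_zero_iff : ∀ (p : Delta S) (q : Q), c p q = 0 ↔ (p : Event S → ℝ) = q

/-- A variational statistical distance for `Q`: moreover `c_Q(p) = min_{q ∈ Q} c(p, q)` is well
defined (the minimum is attained), grounded, lower semicontinuous and convex. -/
structure IsVariationalStatDistance {S : Type*} [MeasurableSpace S] (Q : Set (Event S → ℝ))
    (c : Delta S → Q → ℝ≥0∞) : Prop extends IsStatDistance Q c where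
  min_attained : ∀ p : Delta S, ∃ q : Q, ∀ q' : Q, c p q ≤ c p q'
  min_grounded : IsGrounded fun p => ⨅ q : Q, c p q
  min_lsc : LowerSemicontinuous fun p => ⨅ q : Q, c p q
  min_convex : IsConvexFn fun p => ⨅ q : Q, c p q

/-! ### Acts and preferences -/

section Preferences

variable {S : Type*} [MeasurableSpace S] {E : Type*} [AddCommGroup E] [Module ℝ E]
  {X : Set E} (hX : Convex ℝ X)

/-- Acts: the `Σ`-measurable, finitely valued functions `S → X`. -/
abbrev Act (S : Type*) [MeasurableSpace S] {E : Type*} (X : Set E) := SimpleFunc S X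

/-- The constant act with value `x`. -/
def cst (S : Type*) [MeasurableSpace S] {E : Type*} {X : Set E} (x : X) : Act S X :=
  SimpleFunc.const S x

/-- The statewise mixture `α f + (1 - α) g` of two acts. -/
def mixAct (α : unitInterval) (f g : Act S X) : Act S X :=
  (f.pair g).map fun z => mix hX α z.1 z.2

/-- The strict part of a binary relation. -/
def Strict {α : Type*} (R : α → α → Prop) (a b : α) : Prop := R a b ∧ ¬ R b a

/-- The symmetric part of a binary relation. -/
def Indiff {α : Type*} (R : α → α → Prop) (a b : α) : Prop := R a b ∧ R b a

/-- The basic conditions, under which a binary relation on acts is called a preference. -/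
structure IsPreference (R : Act S X → Act S X → Prop) : Prop where
  refl : ∀ f, R f f
  trans : ∀ f g h, R f g → R g h → R f h
  monotone : ∀ f g : Act S X, (∀ s, R (cst S (f s)) (cst S (g s))) → R f g
  closed_left : ∀ f g h : Act S X, IsClosed {α : unitInterval | R (mixAct hX α f g) h}
  closed_right : ∀ f g h : Act S X, IsClosed {α : unitInterval | R h (mixAct hX α f g)}
  nontrivial : ∃ f g : Act S X, Strict R f g

/-- Unboundedness. -/
def IsUnboundedPref (R : Act S X → Act S X → Prop) : Prop :=
  ∀ x y : X, Strict R (cst S x) (cst S y) →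
    ∃ z z' : X, R (cst S (mix hX half z y)) (cst S x) ∧
      R (cst S y) (cst S (mix hX half x z'))

/-- A (subjectively) rational preference. -/
structure IsRational (R : Act S X → Act S X → Prop) : Prop extends IsPreference hX R where
  complete : ∀ f g, R f g ∨ R g f
  risk_independent : ∀ (x y z : X) (α : unitInterval), 0 < α → α < 1 →
    Indiff R (cst S x) (cst S y) →
      Indiff R (cst S (mix hX α x z)) (cst S (mix hX α y z))

/-- A dominance relation (an objectively rational preference), given the models `Q`. -/
structure IsDominance (Q : Set (Event S → ℝ)) (R : Act S X → Act S X → Prop) : Prop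
    extends IsPreference hX R where
  c_complete : ∀ x y : X, R (cst S x) (cst S y) ∨ R (cst S y) (cst S x)
  complete_of_singleton : (∃ q, Q = {q}) → ∀ f g, R f g ∨ R g f
  weak_c_independent : ∀ (f g : Act S X) (x y : X) (α : unitInterval), 0 < α → α < 1 →
    R (mixAct hX α f (cst S x)) (mixAct hX α g (cst S x)) →
      R (mixAct hX α f (cst S y)) (mixAct hX α g (cst S y))
  convex : ∀ (f g h : Act S X) (α : unitInterval), 0 < α → α < 1 →
    R f h → R g h → R (mixAct hX α f g) h

/-- The independence axiom. -/
def IsIndependent (R : Act S X → Act S X → Prop) : Prop :=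
  ∀ (f g h : Act S X) (α : unitInterval), 0 < α → α < 1 →
    (R f g ↔ R (mixAct hX α f h) (mixAct hX α g h))

/-- Consistency of the mental relation `Rs` and the behavioral relation `R`. -/
def Consistency (Rs R : Act S X → Act S X → Prop) : Prop := ∀ f g, Rs f g → R f g

/-- Caution. -/
def Caution (Rs R : Act S X → Act S X → Prop) : Prop :=
  ∀ (x : X) (f : Act S X), ¬ Rs f (cst S x) → R (cst S x) f

/-- `f` and `g` are equal with `q`-probability one, for every `q ∈ Q`. -/
def QEq (Q : Set (Event S → ℝ)) (f g : Act S X) : Prop :=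
  ∀ q ∈ Q, q ⟨{s | f s = g s}, (f.pair g).measurableSet_preimage {z | z.1 = z.2}⟩ = 1

/-- Objective `Q`-coherence. -/
def ObjectiveCoherence (Q : Set (Event S → ℝ)) (Rs : Act S X → Act S X → Prop) : Prop :=
  ∀ f g : Act S X, QEq Q f g → Indiff Rs f g

/-- `u` is an affine utility function representing `R` on consequences. -/
def IsAffineUtility (R : Act S X → Act S X → Prop) (u : X → ℝ) : Prop :=
  IsAffineFn hX u ∧ ∀ x y : X, R (cst S x) (cst S y) ↔ u y ≤ u x

/-- `y ∈ X_f^p`, i.e. `u(y) = ∫ u(f) dp` where `u` is an affine utility function that represents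
`R` on consequences (such a `u` is unique up to positive affine transformations, and the
equality does not depend on its choice). -/
def IsModelEquivalent (R : Act S X → Act S X → Prop) (p : Event S → ℝ) (f : Act S X) (y : X) :
    Prop :=
  ∃ u : X → ℝ, IsAffineUtility hX R u ∧ u y = integ p (f.map u)

/-- Subjective `Q`-coherence: a model `p` belongs to the weak* closed convex hull of `Q` if and
only if `x ≻* x_f^p` implies `x ≻ f`, for all acts `f` and consequences `x`. -/
def SubjectiveCoherence (Q : Set (Event S → ℝ)) (Rs R : Act S X → Act S X → Prop) : Prop :=
  ∀ p ∈ Delta S,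
    (∀ (f : Act S X) (x y : X), IsModelEquivalent hX R p f y →
      Strict Rs (cst S x) (cst S y) → Strict R (cst S x) f) ↔
    p ∈ closure (convexHull ℝ Q)

end Preferences

/-! ### Decision criteria -/

/-- The objective `∫ u(f) dp + k(p)` of a variational criterion with index `k`. -/
noncomputable def penalized {S : Type*} [MeasurableSpace S] {E : Type*} {X : Set E} (u : X → ℝ)
    (k : Delta S → ℝ≥0∞) (f : Act S X) (p : Delta S) : EReal :=
  ((integ (p : Event S → ℝ) (f.map u) : ℝ) : EReal) + ((k p : ℝ≥0∞) : EReal)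

/-- The variational criterion `V(f) = min_{p ∈ Δ} {∫ u(f) dp + k(p)}`. -/
noncomputable def varValue {S : Type*} [MeasurableSpace S] {E : Type*} {X : Set E} (u : X → ℝ)
    (k : Delta S → ℝ≥0∞) (f : Act S X) : EReal :=
  ⨅ p : Delta S, penalized u k f p

/-- The max-min criterion `V(f) = min_{q ∈ Q} ∫ u(f) dq`. -/
noncomputable def maxminValue {S : Type*} [MeasurableSpace S] {E : Type*} {X : Set E} (u : X → ℝ)
    (Q : Set (Event S → ℝ)) (f : Act S X) : ℝ :=
  ⨅ q : Q, integ (q : Event S → ℝ) (f.map u)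

/-- `h` attains its minimum, so that its infimum is a minimum. -/
def AttainsMin {ι β : Type*} [LE β] (h : ι → β) : Prop := ∃ i, ∀ j, h i ≤ h j

end TwoPref

open TwoPref

namespace TwoPref

/-! Independence and continuity on constant acts give an affine utility `u`, and unboundedness makes
it onto `ℝ`. Every simple function is then the utility profile of an act, and by monotonicity and
independence the mental relation is encoded by one convex cone of profiles: f is weakly preferred to
g iff u(f) - u(g) lies in `prefCone` (`rel_iff_sub_mem_prefCone`). A profile outside this cone has
negative integral under some finitely additive probability that is nonnegative on the cone
(`exists_Delta_separating_prefCone`).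

The heart of `exists_isRepresented` is that the cone consists of the profiles with nonnegative
integral under every q in Q. If q in Q gave a cone element a negative integral, subjective coherence
and consistency would contradict each other. Conversely, caution shows that a separating probability
passes the coherence test, hence belongs to Q. This is the dominance representation. An act is
therefore mentally preferred to x iff u(x) is at most its minimal expected utility over Q;
consistency bounds the act from below by that value, caution and continuity from above, which is the
max-min representation.

For the converse the axioms are verified from the two integral formulas. Compactness of Q gives
attained minima and continuity, and Hahn-Banach with integrals of simple functions as dual gives
subjective coherence. The variational form adds only that the minimum of the penalties of the points
of Q is the penalty of Q (`iInf_indicatorFn_singleton`). -/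

/-- A linear functional that is nonnegative on a convex cone and normalized at an order unit. -/
theorem exists_linearMap_nonneg_on_cone {V : Type*} [AddCommGroup V] [Module ℝ V] (K : Set V)
    (h0 : (0 : V) ∈ K) (hadd : ∀ v ∈ K, ∀ w ∈ K, v + w ∈ K)
    (hsmul : ∀ c : ℝ, 0 < c → ∀ v ∈ K, c • v ∈ K) (d : V) (hd : -d ∉ K)
    (hunit : ∀ v, ∃ t : ℝ, t • d + v ∈ K) :
    ∃ L : V →ₗ[ℝ] ℝ, L d = 1 ∧ ∀ v ∈ K, 0 ≤ L v := by
  have hd0 : d ≠ 0 := by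
    rintro rfl
    exact hd (by simpa using h0)
  let C : PointedCone ℝ V :=
    { carrier := K
      zero_mem' := h0
      add_mem' := fun {a b} ha hb => hadd a ha b hb
      smul_mem' := fun c v hv => by
        rcases c.2.eq_or_lt with hc | hc
        · have : c = 0 := Subtype.ext hc.symm
          rw [this, zero_smul]
          exact h0
        · exact hsmul c hc v hv }
  obtain ⟨L, hL, hLK⟩ := riesz_extension C (LinearPMap.mkSpanSingleton d (1 : ℝ) hd0) (by
    rintro ⟨x, hx⟩ hxK
    obtain ⟨c, rfl⟩ := Submodule.mem_span_singleton.1 hx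
    have hval := LinearPMap.mkSpanSingleton'_apply (σ := RingHom.id ℝ) d (1 : ℝ)
      (fun c hc => by simp [(smul_eq_zero.1 hc).resolve_right hd0]) c hx
    change 0 ≤ LinearPMap.mkSpanSingleton' d (1 : ℝ) _ _
    rw [hval]
    -- A negative multiple of d in K would rescale to -d.
    by_contra hc
    have hc' : c < 0 := by simpa using hc
    refine hd ?_
    have := hsmul (-c)⁻¹ (inv_pos.2 (neg_pos.2 hc')) _ hxK
    rwa [smul_smul, inv_neg, neg_mul, inv_mul_cancel₀ hc'.ne, neg_one_smul] at this) (fun y => by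
    obtain ⟨t, ht⟩ := hunit y
    exact ⟨⟨t • d, Submodule.mem_span_singleton.2 ⟨t, rfl⟩⟩, ht⟩)
  refine ⟨L, ?_, hLK⟩
  have h1 := hL ⟨d, Submodule.mem_span_singleton_self d⟩
  rwa [LinearPMap.mkSpanSingleton_apply] at h1

/-! ### Integration against finitely additive probabilities and its duality with simple functions.
-/

section Integral

variable {S : Type*} [MeasurableSpace S]

open Classical in
/-- The operator-valued set function that extends a function on events by zero. -/
noncomputable def setOp (p : Event S → ℝ) (A : Set S) : ℝ →L[ℝ] ℝ :=
  if h : MeasurableSet A then p ⟨A, h⟩ • ContinuousLinearMap.id ℝ ℝ else 0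

theorem setOp_apply (p : Event S → ℝ) {A : Set S} (h : MeasurableSet A) (x : ℝ) :
    setOp p A x = p ⟨A, h⟩ * x := by
  simp [setOp, h]

theorem integ_eq_setToSimpleFunc (p : Event S → ℝ) (φ : SimpleFunc S ℝ) :
    integ p φ = SimpleFunc.setToSimpleFunc (setOp p) φ := by
  refine Finset.sum_congr rfl fun r _ => ?_
  rw [setOp_apply p (φ.measurableSet_fiber r), mul_comm]

/-- Over the zero measure all finiteness and integrability side conditions are trivial, so the
linearity of `setToSimpleFunc` becomes available for a merely finitely additive p. -/
theorem finMeasAdditive_setOp {p : Event S → ℝ} (hp : p ∈ Delta S) :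
    FinMeasAdditive (0 : Measure S) (setOp p) := by
  intro A B hA hB _ _ hAB
  ext
  rw [add_apply, setOp_apply p hA, setOp_apply p hB, setOp_apply p (hA.union hB)]
  rw [hp.2.2 ⟨A, hA⟩ ⟨B, hB⟩ hAB]
  ring

theorem integ_add {p : Event S → ℝ} (hp : p ∈ Delta S) (φ ψ : SimpleFunc S ℝ) :
    integ p (φ + ψ) = integ p φ + integ p ψ := by
  simp only [integ_eq_setToSimpleFunc]
  exact SimpleFunc.setToSimpleFunc_add _ (finMeasAdditive_setOp hp) (by simp) (by simp)

theorem integ_smul {p : Event S → ℝ} (hp : p ∈ Delta S) (c : ℝ) (φ : SimpleFunc S ℝ) :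
    integ p (c • φ) = c * integ p φ := by
  simp only [integ_eq_setToSimpleFunc]
  exact SimpleFunc.setToSimpleFunc_smul_real _ (finMeasAdditive_setOp hp) c (by simp)

/-- Integration with respect to a finitely additive probability, as a linear functional. -/
noncomputable def integL {p : Event S → ℝ} (hp : p ∈ Delta S) : SimpleFunc S ℝ →ₗ[ℝ] ℝ where
  toFun := integ p
  map_add' := integ_add hp
  map_smul' := integ_smul hp

theorem integ_sub {p : Event S → ℝ} (hp : p ∈ Delta S) (φ ψ : SimpleFunc S ℝ) :
    integ p (φ - ψ) = integ p φ - integ p ψ :=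
  map_sub (integL hp) φ ψ

theorem integ_nonneg {p : Event S → ℝ} (hp : p ∈ Delta S) {φ : SimpleFunc S ℝ} (h : 0 ≤ φ) :
    0 ≤ integ p φ := by
  rw [integ_eq_setToSimpleFunc]
  refine SimpleFunc.setToSimpleFunc_nonneg' (μ := (0 : Measure S)) _ (fun A hA _ x hx => ?_) φ h
    (by simp)
  rw [setOp_apply p hA]
  exact mul_nonneg (hp.1 _) hx

theorem integ_mono {p : Event S → ℝ} (hp : p ∈ Delta S) {φ ψ : SimpleFunc S ℝ} (h : φ ≤ ψ) :
    integ p φ ≤ integ p ψ := by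
  rw [← sub_nonneg, ← integ_sub hp]
  exact integ_nonneg hp fun s => sub_nonneg.2 (h s)

theorem integ_const {p : Event S → ℝ} (hp : p ∈ Delta S) (r : ℝ) :
    integ p (SimpleFunc.const S r) = r := by
  rw [integ_eq_setToSimpleFunc,
    SimpleFunc.setToSimpleFunc_const _ (finMeasAdditive_setOp hp).map_empty_eq_zero,
    setOp_apply p MeasurableSet.univ, hp.2.1, one_mul]

/-- The indicator of an event, as a simple function. -/
noncomputable def ind (A : Event S) : SimpleFunc S ℝ :=
  SimpleFunc.piecewise A.1 A.2 (SimpleFunc.const S 1) (SimpleFunc.const S 0)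

theorem ind_apply_mem {A : Event S} {s : S} (h : s ∈ A.1) : ind A s = 1 := by
  simp [ind, h]

theorem ind_apply_notMem {A : Event S} {s : S} (h : s ∉ A.1) : ind A s = 0 := by
  simp [ind, h]

theorem integ_ind {p : Event S → ℝ} (hp : p ∈ Delta S) (A : Event S) : integ p (ind A) = p A := by
  rw [integ_eq_setToSimpleFunc, ind,
    SimpleFunc.setToSimpleFunc_indicator _ (finMeasAdditive_setOp hp).map_empty_eq_zero,
    setOp_apply p A.2, mul_one]

theorem sum_smul_ind (φ : SimpleFunc S ℝ) :
    ∑ r ∈ φ.range, r • ind ⟨φ ⁻¹' {r}, φ.measurableSet_fiber r⟩ = φ := by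
  ext s
  have hsum : ∀ F : Finset ℝ, (∑ r ∈ F, r • ind ⟨φ ⁻¹' {r}, φ.measurableSet_fiber r⟩) s
      = ∑ r ∈ F, r * ind ⟨φ ⁻¹' {r}, φ.measurableSet_fiber r⟩ s := by
    intro F
    induction F using Finset.induction_on with
    | empty => simp
    | insert a F ha ih => simp [Finset.sum_insert ha, ih]
  rw [hsum, Finset.sum_eq_single (φ s)]
  · rw [ind_apply_mem (by simp), mul_one]
  · intro r _ hr
    rw [ind_apply_notMem (by simpa using hr.symm), mul_zero]
  · intro h
    exact absurd (SimpleFunc.mem_range_self φ s) h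

/-- A positive normalized linear functional on simple functions is integration with respect to
a finitely additive probability. -/
theorem exists_mem_Delta_integ_eq (L : SimpleFunc S ℝ →ₗ[ℝ] ℝ)
    (hpos : ∀ φ, 0 ≤ φ → 0 ≤ L φ) (hone : L (SimpleFunc.const S 1) = 1) :
    ∃ p ∈ Delta S, ∀ φ, integ p φ = L φ := by
  refine ⟨fun A => L (ind A), ⟨fun A => hpos _ fun s => ?_, ?_, fun A B hAB => ?_⟩, fun φ => ?_⟩
  · by_cases h : s ∈ A.1
    · simp [ind_apply_mem h]
    · simp [ind_apply_notMem h]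
  · rw [← hone]
    refine congrArg L (SimpleFunc.ext fun s => ?_)
    simp [ind]
  · rw [← map_add]
    refine congrArg L (SimpleFunc.ext fun s => ?_)
    rw [SimpleFunc.add_apply]
    by_cases hA : s ∈ A.1
    · have hB : s ∉ B.1 := Set.disjoint_left.1 hAB hA
      rw [ind_apply_mem (Or.inl hA), ind_apply_mem hA, ind_apply_notMem hB, add_zero]
    · by_cases hB : s ∈ B.1
      · rw [ind_apply_mem (Or.inr hB), ind_apply_notMem hA, ind_apply_mem hB, zero_add]
      · rw [ind_apply_notMem (by simp [hA, hB]), ind_apply_notMem hA, ind_apply_notMem hB, add_zero]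
  · conv_rhs => rw [← sum_smul_ind φ, map_sum]
    exact Finset.sum_congr rfl fun r _ => by rw [map_smul, smul_eq_mul]

theorem continuous_integ (φ : SimpleFunc S ℝ) : Continuous fun p : Event S → ℝ => integ p φ := by
  unfold integ
  fun_prop

/-- A continuous linear functional for setwise convergence is integration of a simple function. -/
theorem exists_simpleFunc_of_continuousLinearMap (F : (Event S → ℝ) →L[ℝ] ℝ) :
    ∃ φ : SimpleFunc S ℝ, ∀ p ∈ Delta S, F p = integ p φ := by
  -- Continuity for the product topology forces a finite combination of coordinate evaluations, and
  -- evaluation at A integrates the indicator of A.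
  have hmem : (F : (Event S → ℝ) →ₗ[ℝ] ℝ) ∈
      Submodule.span ℝ (Set.range fun A : Event S => LinearMap.proj (R := ℝ) (φ := fun _ => ℝ) A) := by
    rw [LinearMap.mem_span_iff_continuous]
    convert! F.continuous using 1
  suffices h : ∀ G ∈ Submodule.span ℝ
      (Set.range fun A : Event S => LinearMap.proj (R := ℝ) (φ := fun _ => ℝ) A),
      ∃ φ : SimpleFunc S ℝ, ∀ p ∈ Delta S, G p = integ p φ from h _ hmem
  intro G hG
  induction hG using Submodule.span_induction with
  | mem G hG =>
    obtain ⟨A, rfl⟩ := hG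
    exact ⟨ind A, fun p hp => (integ_ind hp A).symm⟩
  | zero => exact ⟨0, fun p hp => ((integL hp).map_zero).symm⟩
  | add G H _ _ hG hH =>
    obtain ⟨φ, hφ⟩ := hG
    obtain ⟨ψ, hψ⟩ := hH
    exact ⟨φ + ψ, fun p hp => by rw [integ_add hp, LinearMap.add_apply, hφ p hp, hψ p hp]⟩
  | smul c G _ hG =>
    obtain ⟨φ, hφ⟩ := hG
    exact ⟨c • φ, fun p hp => by rw [integ_smul hp, LinearMap.smul_apply, hφ p hp, smul_eq_mul]⟩

/-- A model outside a closed convex set of models is separated from it by a simple function. -/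
theorem exists_simpleFunc_separating {Q : Set (Event S → ℝ)} (hQ : Q ⊆ Delta S)
    (hcl : IsClosed Q) (hcvx : Convex ℝ Q) {p : Event S → ℝ} (hp : p ∈ Delta S) (hpQ : p ∉ Q) :
    ∃ (φ : SimpleFunc S ℝ) (r : ℝ), integ p φ < r ∧ ∀ q ∈ Q, r < integ q φ := by
  obtain ⟨F, r, h1, h2⟩ := geometric_hahn_banach_point_closed hcvx hcl hpQ
  obtain ⟨φ, hφ⟩ := exists_simpleFunc_of_continuousLinearMap F
  exact ⟨φ, r, hφ p hp ▸ h1, fun q hq => hφ q (hQ hq) ▸ h2 q hq⟩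

end Integral

/-! ### Mixture calculus and von Neumann-Morgenstern utility. -/

section ExpectedUtility

variable {E : Type*} [AddCommGroup E] [Module ℝ E] {X : Set E} (hX : Convex ℝ X)

/-- The weight `c / (c + d)`. -/
noncomputable def weight {c d : ℝ} (hc : 0 < c) (hd : 0 < d) : unitInterval :=
  ⟨c / (c + d), by positivity, by rw [div_le_one (by positivity)]; linarith⟩

section Weight

variable {c d : ℝ} (hc : 0 < c) (hd : 0 < d)

theorem weight_pos : 0 < weight hc hd := by
  rw [← Subtype.coe_lt_coe]
  exact div_pos hc (add_pos hc hd)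

theorem weight_lt_one : weight hc hd < 1 := by
  rw [← Subtype.coe_lt_coe]
  exact (div_lt_one (add_pos hc hd)).2 (by linarith)

/-- Clearing the denominator turns identities between mixtures into linear identities in `E`; this
is why weights are written c / (c + d). -/
theorem smul_mix_weight (x y : X) :
    (c + d) • ((mix hX (weight hc hd) x y : X) : E) = c • (x : E) + d • (y : E) := by
  have h : c + d ≠ 0 := (add_pos hc hd).ne'
  have h1 : (c + d) * (c / (c + d)) = c := mul_div_cancel₀ _ h
  have h2 : (c + d) * (1 - c / (c + d)) = d := by rw [mul_sub, h1]; ring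
  simp only [mix, weight, smul_add, smul_smul, h1, h2]

theorem mix_weight_eq {x y x' y' : X} (h : c • (x : E) + d • (y : E) = c • (x' : E) + d • (y' : E)) :
    mix hX (weight hc hd) x y = mix hX (weight hc hd) x' y' := by
  refine Subtype.ext (smul_right_injective E (add_pos hc hd).ne' ?_)
  simp only [smul_mix_weight, h]

theorem mix_weight_comm (x y : X) :
    mix hX (weight hc hd) x y = mix hX (weight hd hc) y x := by
  refine Subtype.ext (smul_right_injective E (add_pos hc hd).ne' ?_)
  simp only [smul_mix_weight]
  rw [add_comm c d, smul_mix_weight, add_comm]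

end Weight

theorem mix_self (α : unitInterval) (x : X) : mix hX α x x = x := by
  apply Subtype.ext
  simp only [mix]
  rw [← add_smul, add_sub_cancel, one_smul]

theorem mix_zero (x y : X) : mix hX 0 x y = y := by
  apply Subtype.ext
  simp [mix]

theorem mix_half_comm (x y : X) : mix hX half x y = mix hX half y x := by
  apply Subtype.ext
  simp only [mix, half]
  module

theorem half_pos' : 0 < half := by
  rw [← Subtype.coe_lt_coe]
  norm_num [half]

theorem half_lt_one' : half < 1 := by
  rw [← Subtype.coe_lt_coe]
  norm_num [half]

/-- The differences, up to scaling, of two points of a convex set form a subspace. -/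
def diffSpace (hX : Convex ℝ X) (hne : X.Nonempty) : Submodule ℝ E where
  carrier := {v | ∃ (c : ℝ) (x y : X), 0 < c ∧ v = c • ((x : E) - y)}
  zero_mem' := ⟨1, ⟨_, hne.some_mem⟩, ⟨_, hne.some_mem⟩, one_pos, by simp⟩
  add_mem' := by
    rintro _ _ ⟨c, x, y, hc, rfl⟩ ⟨d, x', y', hd, rfl⟩
    refine ⟨c + d, mix hX (weight hc hd) x x', mix hX (weight hc hd) y y', add_pos hc hd, ?_⟩
    rw [smul_sub (c + d), smul_mix_weight, smul_mix_weight]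
    module
  smul_mem' := by
    rintro a _ ⟨c, x, y, hc, rfl⟩
    rcases lt_trichotomy a 0 with ha | rfl | ha
    · refine ⟨-a * c, y, x, mul_pos (neg_pos.2 ha) hc, ?_⟩
      module
    · exact ⟨1, x, x, one_pos, by simp⟩
    · exact ⟨a * c, x, y, mul_pos ha hc, by module⟩

/-- The difference of two points, as an element of `diffSpace`. -/
def diff (hX : Convex ℝ X) (hne : X.Nonempty) (x y : X) : diffSpace hX hne :=
  ⟨(x : E) - y, 1, x, y, one_pos, (one_smul ℝ _).symm⟩

/-- A complete preorder on a convex set satisfying the von Neumann-Morgenstern axioms. -/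
structure IsVNM (P : X → X → Prop) : Prop where
  trans : ∀ x y z, P x y → P y z → P x z
  total : ∀ x y, P x y ∨ P y x
  indep : ∀ (x y z : X) (α : unitInterval), 0 < α → α < 1 →
    (P x y ↔ P (mix hX α x z) (mix hX α y z))
  closed_left : ∀ x y z : X, IsClosed {α : unitInterval | P (mix hX α x y) z}
  closed_right : ∀ x y z : X, IsClosed {α : unitInterval | P z (mix hX α x y)}

namespace IsVNM

variable {hX} {P : X → X → Prop} (hP : IsVNM hX P)
include hP

theorem refl (x : X) : P x x := (hP.total x x).elim id id

theorem mix_weight_mix {c d : ℝ} (hc : 0 < c) (hd : 0 < d) {x y x' y' : X} (h : P x y)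
    (h' : P x' y') : P (mix hX (weight hc hd) x x') (mix hX (weight hc hd) y y') := by
  refine hP.trans _ (mix hX (weight hc hd) y x') _
    ((hP.indep _ _ _ _ (weight_pos hc hd) (weight_lt_one hc hd)).1 h) ?_
  rw [mix_weight_comm, mix_weight_comm hX hc hd y y']
  exact (hP.indep _ _ _ _ (weight_pos hd hc) (weight_lt_one hd hc)).1 h'

/-- The hypothesis rearranges to c x + d y' = c y + d x', so x mixed with y' is y mixed with x'.
Independence inserts y' and then cancels y. Hence a ranking depends only on the direction of the
difference. -/
theorem of_smul_sub_eq {c d : ℝ} (hc : 0 < c) (hd : 0 < d) {x y x' y' : X} (h : P x y)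
    (heq : c • ((x : E) - y) = d • ((x' : E) - y')) : P x' y' := by
  have h1 := (hP.indep x y y' _ (weight_pos hc hd) (weight_lt_one hc hd)).1 h
  have h2 : mix hX (weight hc hd) x y' = mix hX (weight hc hd) y x' := by
    apply mix_weight_eq
    rw [smul_sub, smul_sub, sub_eq_sub_iff_add_eq_add] at heq
    rw [heq, add_comm]
  rw [h2, mix_weight_comm, mix_weight_comm hX hc hd y y'] at h1
  exact (hP.indep _ _ _ _ (weight_pos hd hc) (weight_lt_one hd hc)).2 h1

/-- The Archimedean property: a strict comparison survives a small perturbation. -/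
theorem exists_mix_of_strict {x y : X} (h : Strict P x y) (a b : X) :
    ∃ α : unitInterval, 0 < α ∧ α < 1 ∧ P (mix hX α a x) (mix hX α b y) := by
  -- The midpoint is strictly between x and y, so by closedness small perturbations of x stay above
  -- it and small perturbations of y below it.
  set m := mix hX half x y with hm
  have hxm : ¬ P m x := fun hmx => h.2 <| by
    rw [hm, mix_half_comm] at hmx
    nth_rewrite 2 [← mix_self hX half x] at hmx
    exact (hP.indep _ _ _ _ half_pos' half_lt_one').2 hmx
  have hym : ¬ P y m := fun hmx => h.2 <| by
    rw [hm] at hmx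
    nth_rewrite 1 [← mix_self hX half y] at hmx
    exact (hP.indep _ _ _ _ half_pos' half_lt_one').2 hmx
  have e1 : ∀ᶠ α in nhds (0 : unitInterval), ¬ P m (mix hX α a x) :=
    (hP.closed_right a x m).isOpen_compl.mem_nhds (by simpa [mix_zero] using hxm)
  have e2 : ∀ᶠ α in nhds (0 : unitInterval), ¬ P (mix hX α b y) m :=
    (hP.closed_left b y m).isOpen_compl.mem_nhds (by simpa [mix_zero] using hym)
  have e3 : ∀ᶠ α in nhds (0 : unitInterval), α < 1 := Iio_mem_nhds one_pos
  have : (nhdsWithin (0 : unitInterval) (Set.Ioi 0)).NeBot :=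
    nhdsGT_neBot_of_exists_gt ⟨1, one_pos⟩
  obtain ⟨α, ⟨h1, h2, h3⟩, h0⟩ :=
    (((e1.and (e2.and e3)).filter_mono nhdsWithin_le_nhds).and
      (self_mem_nhdsWithin : Set.Ioi (0 : unitInterval) ∈ nhdsWithin 0 (Set.Ioi 0))).exists
  exact ⟨α, h0, h3, hP.trans _ m _ ((hP.total _ _).resolve_left h1) ((hP.total _ _).resolve_left h2)⟩

/-- The von Neumann-Morgenstern theorem. -/
theorem exists_affine (hnt : ∃ x y, Strict P x y) :
    ∃ u : X → ℝ, IsAffineFn hX u ∧ ∀ x y, P x y ↔ u y ≤ u x := by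
  obtain ⟨e, o, heo⟩ := hnt
  have hne : X.Nonempty := ⟨_, e.2⟩
  let K : Set (diffSpace hX hne) :=
    {v | ∃ (c : ℝ) (x y : X), 0 < c ∧ (v : E) = c • ((x : E) - y) ∧ P x y}
  have hadd : ∀ v ∈ K, ∀ w ∈ K, v + w ∈ K := by
    rintro v ⟨c, x, y, hc, hv, hxy⟩ w ⟨d, x', y', hd, hw, hxy'⟩
    refine ⟨c + d, _, _, add_pos hc hd, ?_, hP.mix_weight_mix hc hd hxy hxy'⟩
    rw [smul_sub, smul_mix_weight, smul_mix_weight, Submodule.coe_add, hv, hw]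
    module
  have hsmul : ∀ c : ℝ, 0 < c → ∀ v ∈ K, c • v ∈ K := by
    rintro a ha v ⟨c, x, y, hc, hv, hxy⟩
    exact ⟨a * c, x, y, mul_pos ha hc, by rw [Submodule.coe_smul, hv, smul_smul], hxy⟩
  have hperturb : ∀ (x y a b : X), Strict P x y →
      ∃ t : ℝ, 0 < t ∧ diff hX hne x y + t • diff hX hne a b ∈ K := by
    intro x y a b h
    obtain ⟨α, h0, h1, hα⟩ := hP.exists_mix_of_strict h a b
    rw [← Subtype.coe_lt_coe] at h0 h1
    have h1' : 0 < 1 - (α : ℝ) := sub_pos.2 h1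
    refine ⟨(1 - (α : ℝ))⁻¹ * α, mul_pos (inv_pos.2 h1') h0, (1 - (α : ℝ))⁻¹, _, _,
      inv_pos.2 h1', ?_, hα⟩
    have h2 : (1 - (α : ℝ))⁻¹ * (1 - (α : ℝ)) = 1 := inv_mul_cancel₀ h1'.ne'
    calc ((x : E) - y) + ((1 - (α : ℝ))⁻¹ * α) • ((a : E) - b)
        = ((1 - (α : ℝ))⁻¹ * (1 - (α : ℝ))) • ((x : E) - y)
            + ((1 - (α : ℝ))⁻¹ * α) • ((a : E) - b) := by rw [h2, one_smul]
      _ = _ := by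
        simp only [mix]
        module
  obtain ⟨L, hL1, hLK⟩ := exists_linearMap_nonneg_on_cone K
    ⟨1, e, e, one_pos, by simp, hP.refl e⟩ hadd hsmul (diff hX hne e o)
    (by
      rintro ⟨c, x, y, hc, hv, hxy⟩
      refine heo.2 (hP.of_smul_sub_eq hc one_pos hxy (hv.symm.trans ?_))
      simp [diff])
    (by
      rintro ⟨v, c, x, y, hc, rfl⟩
      rcases hP.total x y with h | h
      · exact ⟨0, c, x, y, hc, by simp, h⟩
      -- The strict pair e, o survives a perturbation by x - y, so its difference is an order unit.
      · obtain ⟨t, ht, hK⟩ := hperturb e o x y heo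
        refine ⟨t⁻¹ * c, ?_⟩
        have := hsmul (t⁻¹ * c) (mul_pos (inv_pos.2 ht) hc) _ hK
        convert! this using 1
        apply Subtype.ext
        simp only [diff, Submodule.coe_add, Submodule.coe_smul, smul_add, smul_smul]
        rw [mul_right_comm, inv_mul_cancel₀ ht.ne', one_mul])
  have hsub : ∀ x y, L (diff hX hne x o) - L (diff hX hne y o) = L (diff hX hne x y) := by
    intro x y
    rw [← map_sub]
    refine congrArg L (Subtype.ext ?_)
    simp [diff]
  refine ⟨fun x => L (diff hX hne x o), fun α x y => ?_, fun x y => ⟨fun h => ?_, fun h => ?_⟩⟩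
  · simp only [← smul_eq_mul, ← map_smul, ← map_add]
    refine congrArg L (Subtype.ext ?_)
    simp only [diff, mix, Submodule.coe_add, Submodule.coe_smul]
    module
  · rw [← sub_nonneg, hsub]
    exact hLK _ ⟨1, x, y, one_pos, (one_smul ℝ _).symm, h⟩
  -- Otherwise y is strictly better than x, and perturbing by o - e, where `L` is -1, would leave
  -- u(y) - u(x) at least t > 0.
  · by_contra hxy
    obtain ⟨t, ht, hK⟩ := hperturb y x o e ⟨(hP.total x y).resolve_left hxy, hxy⟩
    have h1 := hLK _ hK
    have h2 : L (diff hX hne o e) = -1 := by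
      rw [← hL1, ← map_neg]
      refine congrArg L (Subtype.ext ?_)
      simp [diff]
    have h3 := hsub y x
    simp only at h
    rw [map_add, map_smul, h2, ← h3, smul_eq_mul] at h1
    linarith

end IsVNM

/-- An affine representation of an unbounded relation is onto the real line. -/
theorem surjective_of_unbounded {P : X → X → Prop} {u : X → ℝ} (hu : IsAffineFn hX u)
    (hP : ∀ x y, P x y ↔ u y ≤ u x) (hnt : ∃ x y, Strict P x y)
    (hunb : ∀ x y, Strict P x y → ∃ z z', P (mix hX half z y) x ∧ P y (mix hX half x z')) :
    Function.Surjective u := by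
  obtain ⟨e, o, heo⟩ := hnt
  have hst : ∀ x y, Strict P x y ↔ u y < u x := fun x y => by
    rw [Strict, hP, hP, not_le]
    exact ⟨And.right, fun h => ⟨h.le, h⟩⟩
  have hpos : 0 < u e - u o := sub_pos.2 ((hst _ _).1 heo)
  have hhalf : ∀ x y, u (mix hX half x y) = (u x + u y) / 2 := fun x y => by
    rw [hu]
    simp only [half]
    ring
  -- Each use of unboundedness at least doubles the utility gap to the fixed endpoint.
  have hup : ∀ n : ℕ, ∃ z, 2 ^ n * (u e - u o) ≤ u z - u o := by
    intro n
    induction n with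
    | zero => exact ⟨e, by simp⟩
    | succ n ih =>
      obtain ⟨z, hz⟩ := ih
      have h1 : 0 < 2 ^ n * (u e - u o) := by positivity
      obtain ⟨w, -, hw, -⟩ := hunb z o ((hst _ _).2 (by linarith))
      rw [hP, hhalf] at hw
      exact ⟨w, by rw [pow_succ]; linarith⟩
  have hdown : ∀ n : ℕ, ∃ z, 2 ^ n * (u e - u o) ≤ u e - u z := by
    intro n
    induction n with
    | zero => exact ⟨o, by simp⟩
    | succ n ih =>
      obtain ⟨z, hz⟩ := ih
      have h1 : 0 < 2 ^ n * (u e - u o) := by positivity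
      obtain ⟨-, w, -, hw⟩ := hunb e z ((hst _ _).2 (by linarith))
      rw [hP, hhalf] at hw
      exact ⟨w, by rw [pow_succ]; linarith⟩
  have hpow : ∀ r : ℝ, ∃ n : ℕ, r < 2 ^ n * (u e - u o) := by
    intro r
    obtain ⟨n, hn⟩ := pow_unbounded_of_one_lt (r / (u e - u o)) one_lt_two
    exact ⟨n, (div_lt_iff₀ hpos).1 hn⟩
  intro t
  obtain ⟨n, hn⟩ := hpow (t - u o)
  obtain ⟨m, hm⟩ := hpow (u e - t)
  obtain ⟨a, ha⟩ := hup n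
  obtain ⟨b, hb⟩ := hdown m
  have hta : 0 < u a - t := by linarith
  have htb : 0 < t - u b := by linarith
  refine ⟨mix hX (weight htb hta) a b, ?_⟩
  rw [hu]
  simp only [weight]
  have : t - u b + (u a - t) ≠ 0 := by linarith
  field_simp
  ring

end ExpectedUtility

/-! ### The max-min functional, and the axioms that follow from the representation. -/

section

variable {S : Type*} [MeasurableSpace S]

/-- The complement of A is null by additivity, and simple functions are bounded, so φ - ψ lies below
a constant times a null indicator. -/
theorem integ_le_of_ae {p : Event S → ℝ} (hp : p ∈ Delta S) {φ ψ : SimpleFunc S ℝ} (A : Event S)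
    (hA : p A = 1) (h : ∀ s ∈ A.1, φ s ≤ ψ s) : integ p φ ≤ integ p ψ := by
  obtain ⟨C, hC⟩ := (φ - ψ).exists_forall_norm_le
  have hcompl : p ⟨A.1ᶜ, A.2.compl⟩ = 0 := by
    have h1 := hp.2.2 A ⟨A.1ᶜ, A.2.compl⟩ disjoint_compl_right
    have h2 : (⟨A.1 ∪ A.1ᶜ, A.2.union A.2.compl⟩ : Event S) = ⟨Set.univ, MeasurableSet.univ⟩ :=
      Subtype.ext (Set.union_compl_self _)
    rw [h2, hp.2.1, hA] at h1
    linarith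
  have h3 : φ - ψ ≤ C • ind ⟨A.1ᶜ, A.2.compl⟩ := by
    intro s
    rw [SimpleFunc.smul_apply]
    by_cases hs : s ∈ A.1
    · rw [ind_apply_notMem (not_not.2 hs), smul_zero]
      exact sub_nonpos.2 (h s hs)
    · rw [ind_apply_mem (A := ⟨A.1ᶜ, A.2.compl⟩) hs, smul_eq_mul, mul_one]
      exact (le_abs_self _).trans (hC s)
  have h4 := integ_mono hp h3
  rw [integ_smul hp, integ_ind hp, hcompl, mul_zero, integ_sub hp] at h4
  linarith

variable {E : Type*} {X : Set E}

theorem cst_map (x : X) (u : X → ℝ) : (cst S x).map u = SimpleFunc.const S (u x) := rfl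

theorem exists_map_eq {u : X → ℝ} (hsurj : Function.Surjective u) (φ : SimpleFunc S ℝ) :
    ∃ f : Act S X, f.map u = φ :=
  ⟨φ.map (Function.surjInv hsurj), SimpleFunc.ext fun s => Function.surjInv_eq hsurj (φ s)⟩

theorem integ_cst (u : X → ℝ) {p : Event S → ℝ} (hp : p ∈ Delta S) (x : X) :
    integ p ((cst S x).map u) = u x :=
  integ_const hp (u x)

section Maxmin

variable {Q : Set (Event S → ℝ)} {u : X → ℝ}

theorem exists_isMin_integ (hQne : Q.Nonempty) (hQcpt : IsCompact Q) (φ : SimpleFunc S ℝ) :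
    ∃ q ∈ Q, ∀ q' ∈ Q, integ q φ ≤ integ q' φ :=
  hQcpt.exists_isMinOn hQne (continuous_integ φ).continuousOn

/-- Compactness makes the real infimum in `maxminValue` a genuine minimum instead of a default
value. -/
theorem exists_maxminValue_eq (hQne : Q.Nonempty) (hQcpt : IsCompact Q) (f : Act S X) :
    ∃ q ∈ Q, maxminValue u Q f = integ q (f.map u) ∧
      ∀ q' ∈ Q, maxminValue u Q f ≤ integ q' (f.map u) := by
  obtain ⟨q, hq, hmin⟩ := exists_isMin_integ hQne hQcpt (f.map u)
  have : maxminValue u Q f = integ q (f.map u) := by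
    have : Nonempty Q := ⟨⟨q, hq⟩⟩
    refine le_antisymm (ciInf_le ⟨integ q (f.map u), ?_⟩ (⟨q, hq⟩ : Q)) (le_ciInf fun q' => hmin q' q'.2)
    rintro _ ⟨q', rfl⟩
    exact hmin q' q'.2
  exact ⟨q, hq, this, fun q' hq' => this ▸ hmin q' hq'⟩

theorem le_maxminValue_iff (hQne : Q.Nonempty) (hQcpt : IsCompact Q) (f : Act S X) (r : ℝ) :
    r ≤ maxminValue u Q f ↔ ∀ q ∈ Q, r ≤ integ q (f.map u) := by
  obtain ⟨q, hq, heq, hle⟩ := exists_maxminValue_eq (u := u) hQne hQcpt f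
  exact ⟨fun h q' hq' => h.trans (hle q' hq'), fun h => heq ▸ h q hq⟩

theorem maxminValue_le_iff (hQne : Q.Nonempty) (hQcpt : IsCompact Q) (f : Act S X) (r : ℝ) :
    maxminValue u Q f ≤ r ↔ ∃ q ∈ Q, integ q (f.map u) ≤ r := by
  obtain ⟨q, hq, heq, hle⟩ := exists_maxminValue_eq (u := u) hQne hQcpt f
  exact ⟨fun h => ⟨q, hq, heq ▸ h⟩, fun ⟨q', hq', h⟩ => (hle q' hq').trans h⟩

theorem maxminValue_cst (hQ : Q ⊆ Delta S) (hQne : Q.Nonempty) (hQcpt : IsCompact Q) (x : X) :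
    maxminValue u Q (cst S x) = u x := by
  obtain ⟨q, hq, heq, -⟩ := exists_maxminValue_eq (u := u) hQne hQcpt (cst S x)
  rw [heq, integ_cst u (hQ hq)]

/-- The integral of a mixture depends jointly continuously on the weight and on the model. -/
theorem continuous_mix_integ (f g : Act S X) :
    Continuous fun z : unitInterval × Q =>
      (z.1 : ℝ) * integ (z.2 : Event S → ℝ) (f.map u)
        + (1 - (z.1 : ℝ)) * integ (z.2 : Event S → ℝ) (g.map u) := by
  have h : ∀ φ : SimpleFunc S ℝ, Continuous fun z : unitInterval × Q =>
      integ (z.2 : Event S → ℝ) φ := fun φ =>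
    (continuous_integ φ).comp (continuous_subtype_val.comp continuous_snd)
  have h1 := h (f.map u)
  have h2 := h (g.map u)
  fun_prop

/-- The dominance and max-min representations of a pair of relations on acts. -/
structure IsRepresented (Q : Set (Event S → ℝ)) (Rs R : Act S X → Act S X → Prop) (u : X → ℝ) :
    Prop where
  mental : ∀ f g : Act S X, Rs f g ↔
    ∀ q : Q, integ (q : Event S → ℝ) (g.map u) ≤ integ (q : Event S → ℝ) (f.map u)
  behavioral : ∀ f g : Act S X, R f g ↔ maxminValue u Q g ≤ maxminValue u Q f

theorem IsRepresented.objectiveCoherence {Rs R : Act S X → Act S X → Prop}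
    (h : IsRepresented Q Rs R u) (hQ : Q ⊆ Delta S) : ObjectiveCoherence Q Rs := by
  intro f g hfg
  refine ⟨(h.mental f g).2 fun q => ?_, (h.mental g f).2 fun q => ?_⟩ <;>
    refine integ_le_of_ae (hQ q.2) _ (hfg q q.2) fun s hs => ?_
  · exact (congrArg u (hs : f s = g s)).ge
  · exact (congrArg u (hs : f s = g s)).le

end Maxmin
namespace IsRepresented

variable {Q : Set (Event S → ℝ)} {Rs R : Act S X → Act S X → Prop} {u : X → ℝ}
  (h : IsRepresented Q Rs R u) (hQ : Q ⊆ Delta S) (hQne : Q.Nonempty) (hQcpt : IsCompact Q)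
  (hsurj : Function.Surjective u)
include h

include hQ hQne in
theorem mental_cst (x y : X) : Rs (cst S x) (cst S y) ↔ u y ≤ u x := by
  obtain ⟨q, hq⟩ := hQne
  rw [h.mental]
  refine ⟨fun h => ?_, fun h q => ?_⟩
  · simpa only [integ_cst u (hQ hq)] using h ⟨q, hq⟩
  · rwa [integ_cst u (hQ q.2), integ_cst u (hQ q.2)]

include hQ hQne hQcpt in
theorem behavioral_cst (x y : X) : R (cst S x) (cst S y) ↔ u y ≤ u x := by
  rw [h.behavioral, maxminValue_cst hQ hQne hQcpt, maxminValue_cst hQ hQne hQcpt]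

include hQ hQne hsurj in
theorem strict_mental : ∃ x y : X, Strict Rs (cst S x) (cst S y) := by
  obtain ⟨x, hx⟩ := hsurj 1
  obtain ⟨y, hy⟩ := hsurj 0
  refine ⟨x, y, ?_, ?_⟩ <;> rw [h.mental_cst hQ hQne, hx, hy] <;> norm_num

include hQne hQcpt in
theorem consistency : Consistency Rs R := by
  intro f g hfg
  rw [h.behavioral, le_maxminValue_iff hQne hQcpt]
  obtain ⟨-, -, -, hle⟩ := exists_maxminValue_eq (u := u) hQne hQcpt g
  exact fun q hq => (hle q hq).trans ((h.mental f g).1 hfg ⟨q, hq⟩)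

include hQ hQne hQcpt in
theorem caution : Caution Rs R := by
  intro x f hxf
  rw [h.mental] at hxf
  push Not at hxf
  obtain ⟨q, hq⟩ := hxf
  rw [integ_cst u (hQ q.2)] at hq
  rw [h.behavioral, maxminValue_cst hQ hQne hQcpt, maxminValue_le_iff hQne hQcpt]
  exact ⟨q, q.2, hq.le⟩

end IsRepresented

variable [AddCommGroup E] [Module ℝ E] {hX : Convex ℝ X}

theorem mixAct_map {u : X → ℝ} (hu : IsAffineFn hX u) (α : unitInterval) (f g : Act S X) :
    (mixAct hX α f g).map u = (α : ℝ) • f.map u + (1 - (α : ℝ)) • g.map u :=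
  SimpleFunc.ext fun s => hu α (f s) (g s)

theorem integ_mixAct {u : X → ℝ} (hu : IsAffineFn hX u) {p : Event S → ℝ} (hp : p ∈ Delta S)
    (α : unitInterval) (f g : Act S X) :
    integ p ((mixAct hX α f g).map u)
      = (α : ℝ) * integ p (f.map u) + (1 - (α : ℝ)) * integ p (g.map u) := by
  rw [mixAct_map hu, integ_add hp, integ_smul hp, integ_smul hp]

/-- A real function of one variable that preserves mixtures is affine. -/
theorem eq_affine_of_preserves_mix {h : ℝ → ℝ}
    (hh : ∀ (α : unitInterval) (s t : ℝ),
      h ((α : ℝ) * s + (1 - (α : ℝ)) * t) = (α : ℝ) * h s + (1 - (α : ℝ)) * h t) (t : ℝ) :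
    h t = (h 1 - h 0) * t + h 0 := by
  -- Each case writes the middle one of 0, 1, t as a mixture of the other two.
  rcases lt_or_ge t 0 with ht | ht
  · have h1 : 0 < 1 - t := by linarith
    have := hh ⟨-t / (1 - t), div_nonneg (by linarith) h1.le, (div_le_one h1).2 (by linarith)⟩ 1 t
    simp only at this
    have e : -t / (1 - t) * 1 + (1 - -t / (1 - t)) * t = 0 := by
      field_simp
      ring
    rw [e] at this
    field_simp at this
    linarith
  rcases le_or_gt t 1 with ht1 | ht1
  · have := hh ⟨t, ht, ht1⟩ 1 0
    simp only [mul_one, mul_zero, add_zero] at this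
    rw [this]
    ring
  · have h1 : 0 < t := by linarith
    have := hh ⟨1 / t, by positivity, (div_le_one h1).2 ht1.le⟩ t 0
    simp only [mul_zero, add_zero, one_div_mul_cancel h1.ne'] at this
    field_simp at this
    linarith

theorem IsAffineUtility.exists_affine_eq {R : Act S X → Act S X → Prop} {u w : X → ℝ}
    (hu : IsAffineUtility hX R u) (hsurj : Function.Surjective u) (hw : IsAffineUtility hX R w) :
    ∃ a b : ℝ, 0 < a ∧ ∀ x, w x = a * u x + b := by
  let v := Function.surjInv hsurj
  have huv : ∀ t, u (v t) = t := Function.surjInv_eq hsurj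
  have hwu : ∀ x y, w y ≤ w x ↔ u y ≤ u x := fun x y => (hw.2 x y).symm.trans (hu.2 x y)
  -- Since w is constant on the level sets of u, it descends to a mixture-preserving function on
  -- `ℝ`.
  have heq : ∀ x y, u x = u y → w x = w y := fun x y h =>
    le_antisymm ((hwu _ _).2 h.le) ((hwu _ _).2 h.ge)
  have haff := eq_affine_of_preserves_mix (h := fun t => w (v t)) (fun α s t => by
    rw [← hw.1]
    refine heq _ _ ?_
    rw [hu.1, huv, huv, huv])
  refine ⟨w (v 1) - w (v 0), w (v 0), ?_, fun x => ?_⟩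
  · rw [sub_pos, ← not_le, hwu, huv, huv]
    norm_num
  · rw [← haff]
    exact heq _ _ (huv _).symm

/-- Any other admissible utility is a positive affine transform of u, and integration against a
probability commutes with such transforms. -/
theorem isModelEquivalent_iff {R : Act S X → Act S X → Prop} {u : X → ℝ}
    (hu : IsAffineUtility hX R u) (hsurj : Function.Surjective u) {p : Event S → ℝ}
    (hp : p ∈ Delta S) (f : Act S X) (y : X) :
    IsModelEquivalent hX R p f y ↔ u y = integ p (f.map u) := by
  refine ⟨fun ⟨w, hw, h⟩ => ?_, fun h => ⟨u, hu, h⟩⟩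
  obtain ⟨a, b, ha, hab⟩ := hu.exists_affine_eq hsurj hw
  have h1 : f.map w = a • f.map u + SimpleFunc.const S b := SimpleFunc.ext fun s => hab (f s)
  rw [h1, integ_add hp, integ_smul hp, integ_const hp, hab] at h
  exact mul_left_cancel₀ ha.ne' (by linarith)

section Maxmin

variable {Q : Set (Event S → ℝ)} {u : X → ℝ}

theorem isClosed_le_maxmin (hQ : Q ⊆ Delta S) (hQne : Q.Nonempty) (hQcpt : IsCompact Q)
    (hu : IsAffineFn hX u) (f g : Act S X) (r : ℝ) :
    IsClosed {α : unitInterval | r ≤ maxminValue u Q (mixAct hX α f g)} := by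
  have h : {α : unitInterval | r ≤ maxminValue u Q (mixAct hX α f g)} =
      ⋂ q : Q, {α : unitInterval | r ≤ (α : ℝ) * integ (q : Event S → ℝ) (f.map u)
        + (1 - (α : ℝ)) * integ (q : Event S → ℝ) (g.map u)} := by
    ext α
    simp only [Set.mem_ofPred_eq, Set.mem_iInter, le_maxminValue_iff hQne hQcpt]
    exact ⟨fun h q => integ_mixAct hu (hQ q.2) α f g ▸ h q q.2,
      fun h q hq => (integ_mixAct hu (hQ hq) α f g).symm ▸ h ⟨q, hq⟩⟩
  rw [h]
  exact isClosed_iInter fun q => isClosed_le continuous_const (by fun_prop)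

/-- A bound from above is existential in the model: the set is the projection of a closed subset of
[0,1] × Q along the compact factor Q. -/
theorem isClosed_maxmin_le (hQ : Q ⊆ Delta S) (hQne : Q.Nonempty) (hQcpt : IsCompact Q)
    (hu : IsAffineFn hX u) (f g : Act S X) (r : ℝ) :
    IsClosed {α : unitInterval | maxminValue u Q (mixAct hX α f g) ≤ r} := by
  have : CompactSpace Q := isCompact_iff_compactSpace.1 hQcpt
  have h : {α : unitInterval | maxminValue u Q (mixAct hX α f g) ≤ r} =
      Prod.fst '' {z : unitInterval × Q | (z.1 : ℝ) * integ (z.2 : Event S → ℝ) (f.map u)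
        + (1 - (z.1 : ℝ)) * integ (z.2 : Event S → ℝ) (g.map u) ≤ r} := by
    ext α
    simp only [Set.mem_ofPred_eq, Set.mem_image, maxminValue_le_iff hQne hQcpt]
    constructor
    · rintro ⟨q, hq, h⟩
      exact ⟨(α, ⟨q, hq⟩), integ_mixAct hu (hQ hq) α f g ▸ h, rfl⟩
    · rintro ⟨⟨β, q⟩, h, rfl⟩
      exact ⟨q, q.2, (integ_mixAct hu (hQ q.2) β f g).symm ▸ h⟩
  rw [h]
  exact isClosedMap_fst_of_compactSpace _ (isClosed_le (continuous_mix_integ f g) continuous_const)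

end Maxmin

namespace IsRepresented

variable {Q : Set (Event S → ℝ)} {Rs R : Act S X → Act S X → Prop} {u : X → ℝ}
  (h : IsRepresented Q Rs R u) (hQ : Q ⊆ Delta S) (hQne : Q.Nonempty) (hQcpt : IsCompact Q)
  (hu : IsAffineFn hX u) (hsurj : Function.Surjective u)
include h

include hQ hQne hu hsurj in
theorem isPreference_mental : IsPreference hX Rs where
  refl f := (h.mental f f).2 fun _ => le_rfl
  trans f g k hfg hgk := (h.mental f k).2 fun q =>
    ((h.mental g k).1 hgk q).trans ((h.mental f g).1 hfg q)
  monotone f g hfg := (h.mental f g).2 fun q =>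
    integ_mono (hQ q.2) fun s => (h.mental_cst hQ hQne _ _).1 (hfg s)
  closed_left f g k := by
    simp only [h.mental, Set.ofPred_forall]
    refine isClosed_iInter fun q => ?_
    simp only [integ_mixAct hu (hQ q.2)]
    exact isClosed_le continuous_const (by fun_prop)
  closed_right f g k := by
    simp only [h.mental, Set.ofPred_forall]
    refine isClosed_iInter fun q => ?_
    simp only [integ_mixAct hu (hQ q.2)]
    exact isClosed_le (by fun_prop) continuous_const
  nontrivial :=
    let ⟨x, y, hxy⟩ := h.strict_mental hQ hQne hsurj
    ⟨_, _, hxy⟩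

include hQ hu in
theorem isIndependent : IsIndependent hX Rs := by
  intro f g k α h0 h1
  rw [h.mental, h.mental]
  refine forall_congr' fun q => ?_
  rw [integ_mixAct hu (hQ q.2), integ_mixAct hu (hQ q.2), add_le_add_iff_right,
    mul_le_mul_iff_right₀ (Subtype.coe_lt_coe.2 h0 : (0 : ℝ) < α)]

include hQ hQne hu hsurj in
theorem isDominance : IsDominance hX Q Rs where
  toIsPreference := h.isPreference_mental hQ hQne hu hsurj
  c_complete x y := by
    rw [h.mental_cst hQ hQne, h.mental_cst hQ hQne]
    exact le_total _ _
  complete_of_singleton := by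
    rintro ⟨q, rfl⟩ f g
    simp only [h.mental, Subtype.forall, Set.mem_singleton_iff, forall_eq]
    exact le_total _ _
  weak_c_independent f g x y α h0 h1 hfg :=
    (h.isIndependent hQ hu f g _ α h0 h1).1 ((h.isIndependent hQ hu f g _ α h0 h1).2 hfg)
  convex f g k α h0 h1 hf hg := by
    rw [h.mental] at hf hg ⊢
    intro q
    have h0' : (0 : ℝ) < α := h0
    have h1' : 0 < 1 - (α : ℝ) := sub_pos.2 h1
    rw [integ_mixAct hu (hQ q.2)]
    nlinarith [mul_le_mul_of_nonneg_left (hf q) h0'.le, mul_le_mul_of_nonneg_left (hg q) h1'.le]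

include hQ hQne hu hsurj in
theorem isUnboundedPref : IsUnboundedPref hX Rs := by
  intro x y _
  -- Reflected utilities, chosen so that the two half mixtures have utilities exactly u(x) and u(y).
  obtain ⟨z, hz⟩ := hsurj (2 * u x - u y)
  obtain ⟨w, hw⟩ := hsurj (2 * u y - u x)
  refine ⟨z, w, ?_, ?_⟩ <;> rw [h.mental_cst hQ hQne, hu] <;> simp only [half, hz, hw] <;> linarith

include hQ hQne hQcpt hu hsurj in
theorem isRational : IsRational hX R where
  refl f := (h.behavioral f f).2 le_rfl
  trans f g k hfg hgk := (h.behavioral f k).2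
    (((h.behavioral g k).1 hgk).trans ((h.behavioral f g).1 hfg))
  monotone f g hfg := h.consistency hQne hQcpt f g <| (h.mental f g).2 fun q =>
    integ_mono (hQ q.2) fun s => (h.behavioral_cst hQ hQne hQcpt _ _).1 (hfg s)
  closed_left f g k := by
    simp only [h.behavioral]
    exact isClosed_le_maxmin hQ hQne hQcpt hu f g _
  closed_right f g k := by
    simp only [h.behavioral]
    exact isClosed_maxmin_le hQ hQne hQcpt hu f g _
  nontrivial := by
    obtain ⟨x, y, hxy⟩ := h.strict_mental hQ hQne hsurj
    refine ⟨cst S x, cst S y, ?_⟩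
    rwa [Strict, h.behavioral_cst hQ hQne hQcpt, h.behavioral_cst hQ hQne hQcpt,
      ← h.mental_cst hQ hQne, ← h.mental_cst hQ hQne]
  complete f g := by
    rw [h.behavioral, h.behavioral]
    exact le_total _ _
  risk_independent x y z α _ _ hxy := by
    simp only [Indiff, h.behavioral_cst hQ hQne hQcpt] at hxy ⊢
    have : u x = u y := le_antisymm hxy.2 hxy.1
    simp only [hu α, this, le_refl, and_self]

include hQ hQne hQcpt hu hsurj in
-- In terms of u, the coherence test says that the integral under p is never below the minimum over
-- Q. Outside Q a separating simple function, realized as an act by surjectivity, violates this.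
theorem subjectiveCoherence (hQcvx : Convex ℝ Q) : SubjectiveCoherence hX Q Rs R := by
  intro p hp
  rw [hQcvx.convexHull_eq, hQcpt.isClosed.closure_eq]
  have hR : IsAffineUtility hX R u := ⟨hu, h.behavioral_cst hQ hQne hQcpt⟩
  simp only [isModelEquivalent_iff hR hsurj hp]
  have hst : ∀ f x, Strict R (cst S x) f ↔ maxminValue u Q f < u x := fun f x => by
    rw [Strict, h.behavioral, h.behavioral, maxminValue_cst hQ hQne hQcpt, not_le]
    exact ⟨And.right, fun h => ⟨h.le, h⟩⟩
  have hsts : ∀ x y, Strict Rs (cst S x) (cst S y) ↔ u y < u x := fun x y => by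
    rw [Strict, h.mental_cst hQ hQne, h.mental_cst hQ hQne, not_le]
    exact ⟨And.right, fun h => ⟨h.le, h⟩⟩
  simp only [hst, hsts]
  constructor
  · intro hall
    by_contra hpQ
    obtain ⟨φ, r, hr, hqr⟩ := exists_simpleFunc_separating hQ hQcpt.isClosed hQcvx hp hpQ
    obtain ⟨f, rfl⟩ := exists_map_eq hsurj φ
    obtain ⟨x, hx⟩ := hsurj r
    obtain ⟨y, hy⟩ := hsurj (integ p (f.map u))
    have := hall f x y hy (by rwa [hx, hy])
    rw [hx, ← not_le, le_maxminValue_iff hQne hQcpt] at this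
    exact this fun q hq => (hqr q hq).le
  · intro hpQ f x y hy hxy
    obtain ⟨-, -, -, hle⟩ := exists_maxminValue_eq (u := u) hQne hQcpt f
    exact (hle p hpQ).trans_lt (hy ▸ hxy)

end IsRepresented

end

/-! ### From the axioms to the representation: the cone of preferred profiles. -/

section

variable {S : Type*} [MeasurableSpace S] {E : Type*} [AddCommGroup E] [Module ℝ E] {X : Set E}
  {hX : Convex ℝ X} {Q : Set (Event S → ℝ)} {Rs R : Act S X → Act S X → Prop}

/-- The form in which mixture continuity is used: a comparison valid for all positive weights passes
to the limit weight 0. -/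
theorem zero_mem_of_isClosed {T : Set unitInterval} (hT : IsClosed T) (h : Set.Ioi 0 ⊆ T) :
    0 ∈ T := by
  refine hT.closure_subset_iff.2 h ?_
  have hne : (Set.Ioi (0 : unitInterval)).Nonempty := ⟨1, zero_lt_one' unitInterval⟩
  rw [closure_Ioi' hne]
  exact Set.self_mem_Ici

theorem IsPreference.exists_strict_cst (h : IsPreference hX Rs)
    (htot : ∀ x y : X, Rs (cst S x) (cst S y) ∨ Rs (cst S y) (cst S x)) :
    ∃ x y : X, Strict Rs (cst S x) (cst S y) := by
  by_contra hno
  push Not at hno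
  have hall : ∀ x y : X, Rs (cst S x) (cst S y) := fun x y => by
    by_contra hxy
    exact hno y x ⟨(htot x y).resolve_left hxy, hxy⟩
  obtain ⟨f, g, -, hgf⟩ := h.nontrivial
  exact hgf (h.monotone g f fun s => hall _ _)

theorem IsDominance.isVNM (h : IsDominance hX Q Rs) (hind : IsIndependent hX Rs) :
    IsVNM hX fun x y => Rs (cst S x) (cst S y) where
  trans _ _ _ := h.trans _ _ _
  total := h.c_complete
  indep x y z α h0 h1 := hind (cst S x) (cst S y) (cst S z) α h0 h1
  closed_left x y z := h.closed_left (cst S x) (cst S y) (cst S z)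
  closed_right x y z := h.closed_right (cst S x) (cst S y) (cst S z)

theorem IsDominance.exists_utility (h : IsDominance hX Q Rs) (hind : IsIndependent hX Rs)
    (hunb : IsUnboundedPref hX Rs) :
    ∃ u : X → ℝ, IsAffineUtility hX Rs u ∧ Function.Surjective u := by
  have hst := h.exists_strict_cst h.c_complete
  obtain ⟨u, hu, hrep⟩ := (h.isVNM hind).exists_affine hst
  exact ⟨u, ⟨hu, hrep⟩, surjective_of_unbounded hX hu hrep hst hunb⟩

/-- A rational preference consistent with a dominance relation ranks consequences in the same
way. -/
theorem IsRational.isAffineUtility (h : IsRational hX R) (hcons : Consistency Rs R) {u : X → ℝ}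
    (hu : IsAffineUtility hX Rs u) (hsurj : Function.Surjective u) : IsAffineUtility hX R u := by
  have hle : ∀ x y, u y ≤ u x → R (cst S x) (cst S y) := fun x y hxy =>
    hcons _ _ ((hu.2 x y).2 hxy)
  refine ⟨hu.1, fun x y => ⟨fun hxy => ?_, hle x y⟩⟩
  by_contra hlt
  rw [not_le] at hlt
  obtain ⟨a, b, hab⟩ := h.toIsPreference.exists_strict_cst fun x y => h.complete _ _
  have hd : 0 < u y - u x := sub_pos.2 hlt
  -- A reversal makes x and y indifferent despite a utility gap. Mixing both with a suitable w moves
  -- half of that gap to any utility level; iterating makes all consequences indifferent.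
  have hstep : ∀ c d : X, u d ≤ u c + (u y - u x) / 2 → R (cst S c) (cst S d) := by
    intro c d hcd
    obtain ⟨w, hw⟩ := hsurj (2 * u c - u x)
    have hind := h.risk_independent x y w half half_pos' half_lt_one' ⟨hxy, hle y x hlt.le⟩
    refine h.trans _ _ _ (hle _ (mix hX half x w) ?_) (h.trans _ _ _ hind.1 (hle _ _ ?_))
    · rw [hu.1, hw]
      simp only [half]
      linarith
    · rw [hu.1, hw]
      simp only [half]
      linarith
  have hn : ∀ (n : ℕ) (c d : X), u d ≤ u c + n * ((u y - u x) / 2) → R (cst S c) (cst S d) := by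
    intro n
    induction n with
    | zero => exact fun c d hcd => hle _ _ (by simpa using hcd)
    | succ n ih =>
      intro c d hcd
      obtain ⟨w, hw⟩ := hsurj (u c + (u y - u x) / 2)
      refine h.trans _ _ _ (hstep c w hw.le) (ih w d ?_)
      push_cast at hcd
      linarith
  obtain ⟨n, hn'⟩ := exists_nat_ge ((u a - u b) / ((u y - u x) / 2))
  rw [div_le_iff₀ (by linarith)] at hn'
  exact hab.2 (hn n b a (by linarith))

section Cone

variable {u : X → ℝ}

theorem IsPreference.of_map_le (h : IsPreference hX Rs) (hu : IsAffineUtility hX Rs u)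
    {f g : Act S X} (hfg : f.map u ≤ g.map u) : Rs g f :=
  h.monotone g f fun s => (hu.2 _ _).2 (hfg s)

theorem IsPreference.congr_map (h : IsPreference hX Rs) (hu : IsAffineUtility hX Rs u)
    {f f' g g' : Act S X} (hf : f.map u = f'.map u) (hg : g.map u = g'.map u) :
    Rs f g ↔ Rs f' g' :=
  ⟨fun hfg => h.trans _ _ _ (h.of_map_le hu hf.le) (h.trans _ _ _ hfg (h.of_map_le hu hg.ge)),
    fun hfg => h.trans _ _ _ (h.of_map_le hu hf.ge) (h.trans _ _ _ hfg (h.of_map_le hu hg.le))⟩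

/-- The utility profiles of the acts that are weakly preferred to a consequence of utility zero. -/
def prefCone (Rs : Act S X → Act S X → Prop) (u : X → ℝ) : Set (SimpleFunc S ℝ) :=
  {φ | ∃ f g : Act S X, f.map u = φ ∧ g.map u = 0 ∧ Rs f g}

variable (h : IsPreference hX Rs) (hind : IsIndependent hX Rs) (hu : IsAffineUtility hX Rs u)
  (hsurj : Function.Surjective u)
include h hu

theorem mem_prefCone_iff {f g : Act S X} (hg : g.map u = 0) :
    f.map u ∈ prefCone Rs u ↔ Rs f g :=
  ⟨fun ⟨_, _, hf', hg', hR⟩ => (h.congr_map hu hf' (hg'.trans hg.symm)).1 hR,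
    fun hR => ⟨f, g, rfl, hg, hR⟩⟩

include hind hsurj

/-- Mixing with an act of zero utility scales the profile, so this is independence read on profiles.
-/
theorem smul_mem_prefCone_iff_of_lt_one {α : unitInterval} (h0 : 0 < α) (h1 : α < 1)
    (φ : SimpleFunc S ℝ) : (α : ℝ) • φ ∈ prefCone Rs u ↔ φ ∈ prefCone Rs u := by
  obtain ⟨f, rfl⟩ := exists_map_eq hsurj φ
  obtain ⟨g, hg⟩ := exists_map_eq hsurj (0 : SimpleFunc S ℝ)
  have h2 : (mixAct hX α g g).map u = 0 := by rw [mixAct_map hu.1, hg, smul_zero, smul_zero, add_zero]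
  have h3 : (mixAct hX α f g).map u = (α : ℝ) • f.map u := by
    rw [mixAct_map hu.1, hg, smul_zero, add_zero]
  rw [mem_prefCone_iff h hu hg, hind f g g α h0 h1, ← mem_prefCone_iff h hu h2, h3]

theorem smul_mem_prefCone {c : ℝ} (hc : 0 < c) {φ : SimpleFunc S ℝ} (hφ : φ ∈ prefCone Rs u) :
    c • φ ∈ prefCone Rs u := by
  rcases lt_trichotomy c 1 with h1 | rfl | h1
  · exact (smul_mem_prefCone_iff_of_lt_one h hind hu hsurj (α := ⟨c, hc.le, h1.le⟩) hc h1 φ).2 hφ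
  · rwa [one_smul]
  · rw [← smul_mem_prefCone_iff_of_lt_one h hind hu hsurj
      (α := ⟨c⁻¹, (inv_pos.2 hc).le, inv_le_one_of_one_le₀ h1.le⟩) (inv_pos.2 hc)
      (inv_lt_one_of_one_lt₀ h1), smul_smul, inv_mul_cancel₀ hc.ne', one_smul]
    exact hφ

/-- Mixing both acts equally with one of profile -u(g) compares (u(f) - u(g))/2 with 0; the factor
1/2 is absorbed by scaling. -/
theorem rel_iff_sub_mem_prefCone (f g : Act S X) :
    Rs f g ↔ f.map u - g.map u ∈ prefCone Rs u := by
  obtain ⟨k, hk⟩ := exists_map_eq hsurj (-(g.map u))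
  have h2 : (mixAct hX half g k).map u = 0 := by
    rw [mixAct_map hu.1, hk]
    simp only [half]
    module
  have h3 : (mixAct hX half f k).map u = (half : ℝ) • (f.map u - g.map u) := by
    rw [mixAct_map hu.1, hk]
    simp only [half]
    module
  rw [hind f g k half half_pos' half_lt_one', ← mem_prefCone_iff h hu h2, h3,
    smul_mem_prefCone_iff_of_lt_one h hind hu hsurj half_pos' half_lt_one']

theorem add_mem_prefCone {φ ψ : SimpleFunc S ℝ} (hφ : φ ∈ prefCone Rs u)
    (hψ : ψ ∈ prefCone Rs u) : φ + ψ ∈ prefCone Rs u := by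
  obtain ⟨f, hf⟩ := exists_map_eq hsurj (φ + ψ)
  obtain ⟨g, hg⟩ := exists_map_eq hsurj ψ
  obtain ⟨k, hk⟩ := exists_map_eq hsurj (0 : SimpleFunc S ℝ)
  rw [← hf, mem_prefCone_iff h hu hk]
  refine h.trans f g k ?_ ?_
  · rwa [rel_iff_sub_mem_prefCone h hind hu hsurj, hf, hg, add_sub_cancel_right]
  · rwa [rel_iff_sub_mem_prefCone h hind hu hsurj, hg, hk, sub_zero]

omit hind in
theorem mem_prefCone_of_nonneg {φ : SimpleFunc S ℝ} (hφ : 0 ≤ φ) : φ ∈ prefCone Rs u := by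
  obtain ⟨f, rfl⟩ := exists_map_eq hsurj φ
  obtain ⟨k, hk⟩ := exists_map_eq hsurj (0 : SimpleFunc S ℝ)
  rw [mem_prefCone_iff h hu hk]
  exact h.of_map_le hu (hk ▸ hφ)

omit hind in
theorem neg_one_notMem_prefCone [Nonempty S] : -SimpleFunc.const S (1 : ℝ) ∉ prefCone Rs u := by
  obtain ⟨x, hx⟩ := hsurj (-1)
  obtain ⟨y, hy⟩ := hsurj 0
  have h1 : (cst S x).map u = -SimpleFunc.const S (1 : ℝ) := by rw [cst_map, hx]; rfl
  have h2 : (cst S y).map u = 0 := by rw [cst_map, hy]; rfl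
  rw [← h1, mem_prefCone_iff h hu h2, hu.2, hx, hy]
  norm_num

omit hind in
-- For t in (0,1] the profile φ + t is a mixture of φ + 1 and φ, so continuity lets t tend to 0.
theorem mem_prefCone_of_forall_add {φ : SimpleFunc S ℝ}
    (hφ : ∀ t : ℝ, 0 < t → φ + t • SimpleFunc.const S (1 : ℝ) ∈ prefCone Rs u) :
    φ ∈ prefCone Rs u := by
  obtain ⟨f, hf⟩ := exists_map_eq hsurj (φ + SimpleFunc.const S (1 : ℝ))
  obtain ⟨g, hg⟩ := exists_map_eq hsurj φ
  obtain ⟨k, hk⟩ := exists_map_eq hsurj (0 : SimpleFunc S ℝ)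
  have hsub : Set.Ioi 0 ⊆ {α : unitInterval | Rs (mixAct hX α f g) k} := by
    intro α hα
    change Rs _ k
    rw [← mem_prefCone_iff h hu hk, mixAct_map hu.1, hf, hg]
    convert! hφ α hα using 1
    module
  have h0 := zero_mem_of_isClosed (h.closed_left f g k) hsub
  have h1 : (mixAct hX 0 f g).map u = φ := by
    rw [mixAct_map hu.1, hg]
    simp
  rw [← h1, mem_prefCone_iff h hu hk]
  exact h0

/-- A profile outside the cone is evaluated negatively by some finitely additive probability that
is nonnegative on the cone. -/
theorem exists_Delta_separating_prefCone [Nonempty S] {φ : SimpleFunc S ℝ}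
    (hφ : φ ∉ prefCone Rs u) :
    ∃ p ∈ Delta S, integ p φ < 0 ∧ ∀ ψ ∈ prefCone Rs u, 0 ≤ integ p ψ := by
  -- The slack t makes the final inequality strict: a functional nonpositive at φ + t is at most -t
  -- at φ.
  obtain ⟨t, ht, htφ⟩ : ∃ t : ℝ, 0 < t ∧ φ + t • SimpleFunc.const S (1 : ℝ) ∉ prefCone Rs u := by
    by_contra! hno
    exact hφ (mem_prefCone_of_forall_add h hu hsurj hno)
  have hone : (0 : SimpleFunc S ℝ) ≤ SimpleFunc.const S (1 : ℝ) := fun _ => zero_le_one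
  set e := SimpleFunc.const S (1 : ℝ) with he
  have hC0 := mem_prefCone_of_nonneg h hu hsurj (le_refl (0 : SimpleFunc S ℝ))
  let K : Set (SimpleFunc S ℝ) := {ψ | ∃ κ ∈ prefCone Rs u, ∃ r : ℝ, 0 ≤ r ∧ ψ = κ - r • (φ + t • e)}
  have hCK : ∀ ψ ∈ prefCone Rs u, ψ ∈ K := fun ψ hψ => ⟨ψ, hψ, 0, le_rfl, by simp⟩
  obtain ⟨L, hL1, hLK⟩ := exists_linearMap_nonneg_on_cone K (hCK _ hC0)
    (by
      rintro _ ⟨κ, hκ, r, hr, rfl⟩ _ ⟨κ', hκ', r', hr', rfl⟩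
      exact ⟨κ + κ', add_mem_prefCone h hind hu hsurj hκ hκ', r + r', add_nonneg hr hr', by module⟩)
    (by
      rintro c hc _ ⟨κ, hκ, r, hr, rfl⟩
      exact ⟨c • κ, smul_mem_prefCone h hind hu hsurj hc hκ, c * r, mul_nonneg hc.le hr, by module⟩)
    e
    (by
      rintro ⟨κ, hκ, r, hr, heq⟩
      -- If -e were in `K`, then either r = 0 and -e is in the cone, or φ + t e = (κ + e)/r is.
      rcases hr.eq_or_lt with rfl | hr
      · rw [zero_smul, sub_zero] at heq
        exact neg_one_notMem_prefCone h hu hsurj (heq ▸ hκ)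
      · refine htφ ?_
        have h1 : φ + t • e = r⁻¹ • (κ + e) := by
          rw [eq_inv_smul_iff₀ hr.ne']
          rw [eq_sub_iff_add_eq, neg_add_eq_sub, sub_eq_iff_eq_add] at heq
          exact heq
        rw [h1]
        exact smul_mem_prefCone h hind hu hsurj (inv_pos.2 hr)
          (add_mem_prefCone h hind hu hsurj hκ (mem_prefCone_of_nonneg h hu hsurj hone)))
    (by
      intro ψ
      obtain ⟨M, hM⟩ := ψ.exists_forall_norm_le
      refine ⟨M, hCK _ (mem_prefCone_of_nonneg h hu hsurj fun s => ?_)⟩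
      have := (abs_le.1 (hM s)).1
      change (0 : ℝ) ≤ M * 1 + ψ s
      linarith)
  obtain ⟨p, hp, hpL⟩ := exists_mem_Delta_integ_eq L
    (fun ψ hψ => hLK _ (hCK _ (mem_prefCone_of_nonneg h hu hsurj hψ))) hL1
  refine ⟨p, hp, ?_, fun ψ hψ => hpL ψ ▸ hLK _ (hCK _ hψ)⟩
  have h1 := hLK (-(φ + t • e)) ⟨0, hC0, 1, zero_le_one, by simp⟩
  rw [map_neg, map_add, map_smul, hL1, smul_eq_mul, mul_one] at h1
  rw [hpL]
  linarith

end Cone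

/-- The axioms imply the dominance and max-min representations. -/
theorem exists_isRepresented (hQ : Q ⊆ Delta S) (hQne : Q.Nonempty) (hQcpt : IsCompact Q)
    (hQcvx : Convex ℝ Q) (hRs : IsDominance hX Q Rs) (hunb : IsUnboundedPref hX Rs)
    (hind : IsIndependent hX Rs) (hR : IsRational hX R) (hcoh : SubjectiveCoherence hX Q Rs R)
    (hcons : Consistency Rs R) (hcaut : Caution Rs R) :
    ∃ u : X → ℝ, IsAffineFn hX u ∧ Function.Surjective u ∧ IsRepresented Q Rs R u := by
  -- On an empty state space the constants 0 and 1 coincide, so no probability exists.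
  have : Nonempty S := by
    by_contra hS
    rw [not_nonempty_iff] at hS
    obtain ⟨q, hq⟩ := hQne
    have h1 := integ_const (hQ hq) 1
    rw [show SimpleFunc.const S (1 : ℝ) = SimpleFunc.const S 0 from
      SimpleFunc.ext fun s => hS.elim s, integ_const (hQ hq)] at h1
    exact zero_ne_one h1
  obtain ⟨u, hu, hsurj⟩ := hRs.exists_utility hind hunb
  have hP := hRs.toIsPreference
  have huR := hR.isAffineUtility hcons hu hsurj
  have hsts : ∀ x y : X, Strict Rs (cst S x) (cst S y) ↔ u y < u x := fun x y => by
    rw [Strict, hu.2, hu.2, not_le]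
    exact ⟨And.right, fun h => ⟨h.le, h⟩⟩
  have hsub : ∀ (f : Act S X) (x : X), Rs f (cst S x) ↔
      f.map u - SimpleFunc.const S (u x) ∈ prefCone Rs u := fun f x =>
    rel_iff_sub_mem_prefCone hP hind hu hsurj f (cst S x)
  have hmemQ : ∀ p ∈ Delta S, (∀ (f : Act S X) (x : X), integ p (f.map u) < u x →
      Strict R (cst S x) f) ↔ p ∈ Q := by
    intro p hp
    have h1 := hcoh p hp
    rw [hQcvx.convexHull_eq, hQcpt.isClosed.closure_eq] at h1
    rw [← h1]
    simp only [isModelEquivalent_iff huR hsurj hp, hsts]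
    refine ⟨fun hall f x y hy hxy => hall f x (hy ▸ hxy), fun hall f x hx => ?_⟩
    obtain ⟨y, hy⟩ := hsurj (integ p (f.map u))
    exact hall f x y hy (hy ▸ hx)
  have hcone : ∀ φ, φ ∈ prefCone Rs u ↔ ∀ q ∈ Q, 0 ≤ integ q φ := by
    intro φ
    refine ⟨fun hφ q hq => ?_, fun hall => ?_⟩
    · by_contra! hneg
      obtain ⟨f, rfl⟩ := exists_map_eq hsurj φ
      -- Half the negative integral puts u(x) strictly between it and 0: coherence ranks x strictly
      -- above f, while consistency ranks f above y, hence above x.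
      obtain ⟨x, hx⟩ := hsurj (integ q (f.map u) / 2)
      obtain ⟨y, hy⟩ := hsurj 0
      have h1 := (hmemQ q (hQ hq)).2 hq f x (by linarith)
      have h2 : Rs f (cst S y) := (hsub f y).2 (by rw [hy]; exact (sub_zero (f.map u)).symm ▸ hφ)
      exact h1.2 (hR.trans _ _ _ (hcons _ _ h2) ((huR.2 _ _).2 (by linarith)))
    · by_contra hφ
      obtain ⟨p, hp, hneg, hpos⟩ := exists_Delta_separating_prefCone hP hind hu hsurj hφ
      refine hneg.not_ge (hall p ((hmemQ p hp).1 fun f x hx => ?_))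
      have hnot : ∀ z, integ p (f.map u) < u z → ¬ Rs f (cst S z) := by
        intro z hz hRz
        have := hpos _ ((hsub f z).1 hRz)
        rw [integ_sub hp, integ_const hp] at this
        linarith
      -- Caution yields only weak preference; applying it also to z strictly below x makes the
      -- preference for x strict.
      obtain ⟨z, hz⟩ := hsurj ((integ p (f.map u) + u x) / 2)
      refine ⟨hcaut _ _ (hnot x hx), fun hfx => ?_⟩
      have h1 := hR.trans _ _ _ (hcaut z f (hnot z (by linarith))) hfx
      rw [huR.2] at h1
      linarith
  have hmental : ∀ f g : Act S X, Rs f g ↔ ∀ q ∈ Q, integ q (g.map u) ≤ integ q (f.map u) := by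
    intro f g
    rw [rel_iff_sub_mem_prefCone hP hind hu hsurj, hcone]
    refine forall₂_congr fun q hq => ?_
    rw [integ_sub (hQ hq), sub_nonneg]
  have hge : ∀ (f : Act S X) (x : X), Rs f (cst S x) ↔ u x ≤ maxminValue u Q f := by
    intro f x
    rw [hmental, le_maxminValue_iff hQne hQcpt]
    refine forall₂_congr fun q hq => ?_
    rw [integ_cst u (hQ hq)]
  have hequiv : ∀ (f : Act S X) (x : X), u x = maxminValue u Q f → Indiff R f (cst S x) := by
    intro f x hx
    refine ⟨hcons _ _ ((hge f x).2 hx.le), ?_⟩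
    -- Mixtures of z into x have utility above the minimum, so caution ranks them above f; letting
    -- the weight vanish gives x above f.
    obtain ⟨z, hz⟩ := hsurj (u x + 1)
    have hsubset : Set.Ioi 0 ⊆ {α : unitInterval | R (mixAct hX α (cst S z) (cst S x)) f} := by
      intro α hα
      refine hcaut (mix hX α z x) f fun hf => ?_
      rw [hge, hu.1, ← hx, hz] at hf
      have : (0 : ℝ) < α := hα
      linarith
    have h0 := zero_mem_of_isClosed (hR.closed_left (cst S z) (cst S x) f) hsubset
    change R (cst S (mix hX 0 z x)) f at h0
    rwa [mix_zero] at h0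
  refine ⟨u, hu.1, hsurj, fun f g => (hmental f g).trans
    ⟨fun h q => h q q.2, fun h q hq => h ⟨q, hq⟩⟩, fun f g => ?_⟩
  obtain ⟨x, hx⟩ := hsurj (maxminValue u Q f)
  obtain ⟨y, hy⟩ := hsurj (maxminValue u Q g)
  have hf := hequiv f x hx
  have hg := hequiv g y hy
  rw [← hx, ← hy, ← huR.2]
  exact ⟨fun h => hR.trans _ _ _ hf.2 (hR.trans _ _ _ h hg.1),
    fun h => hR.trans _ _ _ hf.1 (hR.trans _ _ _ h hg.2)⟩

end

/-! ### Indicator penalties and the variational form of the criteria. -/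

section

variable {S : Type*} [MeasurableSpace S] {Q C : Set (Event S → ℝ)}

section Indicator

theorem indicatorFn_of_mem {p : Delta S} (h : (p : Event S → ℝ) ∈ C) : indicatorFn C p = 0 :=
  if_pos h

theorem indicatorFn_of_notMem {p : Delta S} (h : (p : Event S → ℝ) ∉ C) : indicatorFn C p = ⊤ :=
  if_neg h

theorem indicatorFn_eq_zero_iff {p : Delta S} :
    indicatorFn C p = 0 ↔ (p : Event S → ℝ) ∈ C := by
  by_cases h : (p : Event S → ℝ) ∈ C
  · simp [indicatorFn_of_mem h, h]
  · simp [indicatorFn_of_notMem h, h]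

theorem isGrounded_indicatorFn (hC : C ⊆ Delta S) (hne : C.Nonempty) :
    IsGrounded (indicatorFn C) := by
  obtain ⟨q, hq⟩ := hne
  refine le_antisymm ((iInf_le _ (⟨q, hC hq⟩ : Delta S)).trans ?_) zero_le
  exact (indicatorFn_of_mem hq).le

theorem lowerSemicontinuous_indicatorFn (hC : IsClosed C) :
    LowerSemicontinuous (indicatorFn C) := by
  intro p y hy
  by_cases h : (p : Event S → ℝ) ∈ C
  · rw [indicatorFn_of_mem h] at hy
    exact absurd hy not_lt_zero
  · filter_upwards [(hC.preimage continuous_subtype_val).isOpen_compl.mem_nhds h] with p' hp'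
    rw [indicatorFn_of_notMem h] at hy
    rwa [indicatorFn_of_notMem (show (p' : Event S → ℝ) ∉ C from hp')]

/-- An infinite value makes the bound trivial unless its weight is 0, where 0 * ⊤ = 0; the mixture
then degenerates to the other point. -/
theorem isConvexFn_indicatorFn (hC : Convex ℝ C) : IsConvexFn (indicatorFn C) := by
  intro α p q
  have hdeg : ∀ p' q' : Delta S, mix (convex_Delta S) 1 p' q' = p' := fun p' q' =>
    Subtype.ext (by simp [mix])
  by_cases hp : (p : Event S → ℝ) ∈ C
  · by_cases hq : (q : Event S → ℝ) ∈ C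
    · rw [indicatorFn_of_mem (hC hp hq α.2.1 (sub_nonneg.2 α.2.2) (add_sub_cancel _ _))]
      exact zero_le
    · rcases eq_or_ne α 1 with rfl | hα
      · rw [hdeg, indicatorFn_of_mem hp]
        exact zero_le
      · have : ENNReal.ofReal (1 - (α : ℝ)) ≠ 0 := by
          rw [Ne, ENNReal.ofReal_eq_zero, not_le, sub_pos]
          exact lt_of_le_of_ne α.2.2 fun h => hα (Subtype.ext h)
        rw [indicatorFn_of_notMem hq, ENNReal.mul_top this, add_top]
        exact le_top
  · rcases eq_or_ne α 0 with rfl | hα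
    · rw [mix_zero]
      simp
    · have : ENNReal.ofReal (α : ℝ) ≠ 0 := by
        rw [Ne, ENNReal.ofReal_eq_zero, not_le]
        exact lt_of_le_of_ne α.2.1 fun h => hα (Subtype.ext h.symm)
      rw [indicatorFn_of_notMem hp, ENNReal.mul_top this, top_add]
      exact le_top

/-- Some singleton penalty vanishes at p exactly when p is in Q. Thus c_Q is itself an indicator,
and its regularity is that of the set Q. -/
theorem iInf_indicatorFn_singleton (p : Delta S) :
    ⨅ q : Q, indicatorFn {(q : Event S → ℝ)} p = indicatorFn Q p := by
  by_cases h : (p : Event S → ℝ) ∈ Q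
  · rw [indicatorFn_of_mem h]
    refine le_antisymm ((iInf_le _ (⟨p, h⟩ : Q)).trans ?_) zero_le
    exact (indicatorFn_of_mem rfl).le
  · rw [indicatorFn_of_notMem h, iInf_eq_top]
    exact fun q => indicatorFn_of_notMem fun hpq => h (hpq ▸ q.2)

theorem isVariationalStatDistance_indicatorFn (hQ : Q ⊆ Delta S) (hne : Q.Nonempty)
    (hcl : IsClosed Q) (hcvx : Convex ℝ Q) :
    IsVariationalStatDistance Q fun p (q : Q) => indicatorFn {(q : Event S → ℝ)} p where
  grounded q := isGrounded_indicatorFn (Set.singleton_subset_iff.2 (hQ q.2)) (Set.singleton_nonempty _)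
  lsc q := lowerSemicontinuous_indicatorFn isClosed_singleton
  convex q := isConvexFn_indicatorFn (convex_singleton _)
  eq_zero_iff _ _ := indicatorFn_eq_zero_iff
  min_attained p := by
    by_cases h : (p : Event S → ℝ) ∈ Q
    · exact ⟨⟨p, h⟩, fun q => (indicatorFn_of_mem rfl).trans_le zero_le⟩
    · obtain ⟨q, hq⟩ := hne
      refine ⟨⟨q, hq⟩, fun q' => ?_⟩
      have hp : (p : Event S → ℝ) ∉ ({(q' : Event S → ℝ)} : Set _) := fun hpq =>
        h (Set.mem_singleton_iff.1 hpq ▸ q'.2)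
      rw [indicatorFn_of_notMem hp]
      exact le_top
  min_grounded := by
    simp only [iInf_indicatorFn_singleton]
    exact isGrounded_indicatorFn hQ hne
  min_lsc := by
    simp only [iInf_indicatorFn_singleton]
    exact lowerSemicontinuous_indicatorFn hcl
  min_convex := by
    simp only [iInf_indicatorFn_singleton]
    exact isConvexFn_indicatorFn hcvx

end Indicator

variable {E : Type*} {X : Set E} {u : X → ℝ}

theorem penalized_of_mem (f : Act S X) {p : Delta S} (h : (p : Event S → ℝ) ∈ C) :
    penalized u (indicatorFn C) f p = (integ (p : Event S → ℝ) (f.map u) : ℝ) := by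
  rw [penalized, indicatorFn_of_mem h, EReal.coe_ennreal_zero, add_zero]

theorem penalized_of_notMem (f : Act S X) {p : Delta S} (h : (p : Event S → ℝ) ∉ C) :
    penalized u (indicatorFn C) f p = ⊤ := by
  rw [penalized, indicatorFn_of_notMem h, EReal.coe_ennreal_top, EReal.coe_add_top]

theorem isMin_penalized_indicatorFn {f : Act S X} {p : Delta S} (hp : (p : Event S → ℝ) ∈ C)
    (hmin : ∀ q ∈ C, integ (p : Event S → ℝ) (f.map u) ≤ integ q (f.map u)) (p' : Delta S) :
    penalized u (indicatorFn C) f p ≤ penalized u (indicatorFn C) f p' := by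
  by_cases h : (p' : Event S → ℝ) ∈ C
  · rw [penalized_of_mem f hp, penalized_of_mem f h]
    exact EReal.coe_le_coe_iff.2 (hmin _ h)
  · rw [penalized_of_notMem f h]
    exact le_top

theorem varValue_indicatorFn {f : Act S X} {p : Delta S} (hp : (p : Event S → ℝ) ∈ C)
    (hmin : ∀ q ∈ C, integ (p : Event S → ℝ) (f.map u) ≤ integ q (f.map u)) :
    varValue u (indicatorFn C) f = (integ (p : Event S → ℝ) (f.map u) : ℝ) := by
  rw [← penalized_of_mem f hp]
  exact le_antisymm (iInf_le _ p) (le_iInf (isMin_penalized_indicatorFn hp hmin))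

theorem varValue_indicatorFn_singleton (hQ : Q ⊆ Delta S) (q : Q) (f : Act S X) :
    varValue u (indicatorFn {(q : Event S → ℝ)}) f
      = (integ (q : Event S → ℝ) (f.map u) : ℝ) :=
  varValue_indicatorFn (C := {(q : Event S → ℝ)}) (p := ⟨q, hQ q.2⟩) (Set.mem_singleton _)
    fun q' h => by rw [Set.mem_singleton_iff.1 h]

theorem varValue_indicatorFn_eq_maxminValue (hQ : Q ⊆ Delta S) (hne : Q.Nonempty)
    (hcpt : IsCompact Q) (f : Act S X) :
    varValue u (indicatorFn Q) f = (maxminValue u Q f : ℝ) := by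
  obtain ⟨q, hq, heq, hle⟩ := exists_maxminValue_eq (u := u) hne hcpt f
  rw [varValue_indicatorFn (p := ⟨q, hQ hq⟩) hq fun q' hq' => heq ▸ hle q' hq', heq]

end

end TwoPref

open TwoPref
theorem mainTheorem4 {S : Type*} [MeasurableSpace S]
    {E : Type*} [AddCommGroup E] [Module ℝ E] {X : Set E} (hX : Convex ℝ X)
    (Q : Set (Event S → ℝ)) (hQσ : Q ⊆ DeltaSigma S) (hQne : Q.Nonempty)
    (hQcpt : IsCompact Q) (hQcvx : Convex ℝ Q)
    (Rs R : Act S X → Act S X → Prop) :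
    ((IsDominance hX Q Rs ∧ IsUnboundedPref hX Rs ∧ IsIndependent hX Rs) ∧
      IsRational hX R ∧
      (ObjectiveCoherence Q Rs ∧ SubjectiveCoherence hX Q Rs R) ∧
      Consistency Rs R ∧ Caution Rs R) ↔
    (∃ (u : X → ℝ) (c : Delta S → Q → ℝ≥0∞),
      IsAffineFn hX u ∧ Function.Surjective u ∧
      IsVariationalStatDistance Q c ∧
      (∀ (p : Delta S) (q : Q), c p q = indicatorFn {(q : Event S → ℝ)} p) ∧
      -- all the minima below are attained
      (∀ (f : Act S X) (q : Q), AttainsMin (penalized u (fun p => c p q) f)) ∧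
      (∀ f : Act S X, AttainsMin (penalized u (fun p => ⨅ q : Q, c p q) f)) ∧
      (∀ f : Act S X, AttainsMin fun q : Q => integ (q : Event S → ℝ) (f.map u)) ∧
      -- the two variational representations
      (∀ f g : Act S X, Rs f g ↔
        ∀ q : Q, varValue u (fun p => c p q) g ≤ varValue u (fun p => c p q) f) ∧
      (∀ f g : Act S X, R f g ↔
        varValue u (fun p => ⨅ q : Q, c p q) g ≤ varValue u (fun p => ⨅ q : Q, c p q) f) ∧
      -- and their reduced forms
      (∀ f g : Act S X, Rs f g ↔
        ∀ q : Q, integ (q : Event S → ℝ) (g.map u) ≤ integ (q : Event S → ℝ) (f.map u)) ∧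
      (∀ f g : Act S X, R f g ↔ maxminValue u Q g ≤ maxminValue u Q f)) := by
  have hQ : Q ⊆ Delta S := fun q hq => (hQσ hq).1
  constructor
  · rintro ⟨⟨hRs, hunb, hind⟩, hR, ⟨-, hcoh⟩, hcons, hcaut⟩
    obtain ⟨u, hu, hsurj, h⟩ :=
      exists_isRepresented hQ hQne hQcpt hQcvx hRs hunb hind hR hcoh hcons hcaut
    refine ⟨u, fun p q => indicatorFn {(q : Event S → ℝ)} p, hu, hsurj,
      isVariationalStatDistance_indicatorFn hQ hQne hQcpt.isClosed hQcvx, fun _ _ => rfl,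
      fun f q => ?_, fun f => ?_, fun f => ?_, fun f g => ?_, fun f g => ?_, h.mental, h.behavioral⟩
    · exact ⟨⟨q, hQ q.2⟩, isMin_penalized_indicatorFn (C := {(q : Event S → ℝ)})
        (Set.mem_singleton _) fun q' h => by rw [Set.mem_singleton_iff.1 h]⟩
    · simp only [iInf_indicatorFn_singleton]
      obtain ⟨q, hq, hmin⟩ := exists_isMin_integ hQne hQcpt (f.map u)
      exact ⟨⟨q, hQ hq⟩, isMin_penalized_indicatorFn hq hmin⟩
    · obtain ⟨q, hq, hmin⟩ := exists_isMin_integ hQne hQcpt (f.map u)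
      exact ⟨⟨q, hq⟩, fun q' => hmin q' q'.2⟩
    · rw [h.mental]
      refine forall_congr' fun q => ?_
      rw [varValue_indicatorFn_singleton hQ, varValue_indicatorFn_singleton hQ,
        EReal.coe_le_coe_iff]
    · simp only [iInf_indicatorFn_singleton]
      rw [h.behavioral, varValue_indicatorFn_eq_maxminValue hQ hQne hQcpt,
        varValue_indicatorFn_eq_maxminValue hQ hQne hQcpt, EReal.coe_le_coe_iff]
  · rintro ⟨u, c, hu, hsurj, -, -, -, -, -, -, -, hmental, hbehavioral⟩
    -- The two reduced forms are precisely `IsRepresented`, from which each axiom has been derived.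
    have h : IsRepresented Q Rs R u := ⟨hmental, hbehavioral⟩
    exact ⟨⟨h.isDominance hQ hQne hu hsurj, h.isUnboundedPref hQ hQne hu hsurj,
      h.isIndependent hQ hu⟩, h.isRational hQ hQne hQcpt hu hsurj,
      ⟨h.objectiveCoherence hQ, h.subjectiveCoherence hQ hQne hQcpt hu hsurj hQcvx⟩,
      h.consistency hQne hQcpt, h.caution hQ hQne hQcpt⟩
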